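/- Let $n\in\mathbb N$, let $U\subset\mathbb R^n$ be open, let $f\in C^2(U\times\mathbb R,\mathbb R^n)$, and let $\Lambda\in C^2(\mathbb R,(\lambda_-,\lambda_+))$ be a parameter shift, i.e. $\Lambda(s)\to\lambda_\pm$ and $\Lambda'(s)\to 0$ as $s\to\pm\infty$. An attracting equilibrium of $\dot x=f(x,\lambda)$ is a point $p\in U$ with $f(p,\lambda)=0$ such that all eigenvalues of $\partial_xf(p,\lambda)$ have negative real part; its basin $\mathbb B(p,\lambda)$ is the set of points of $U$ whose forward solution under $\dot x=f(x,\lambda)$ exists for all $t\ge 0$, stays in $U$ and converges to $p$. A stable path $(X(s),\Lambda(s))$ is a continuous $X:\mathbb R\to U$ such that $X(s)$ is an attracting equilibrium of $\dot x=f(x,\Lambda(s))$ for every $s\in\mathbb R$. It is forward basin stable (FBS) if $\overline{\{X(u):u<s\}}\subset\mathbb B(X(s),\Lambda(s))$ for all $s\in\mathbb R$. Let $(X(s),\Lambda(s))$ be a stable path such that the limits $X_\pm=\lim_{s\to\pm\infty}X(s)$ exist, $X_-$ being an attracting equilibrium for $\lambda=\lambda_-$. For a parameter shift $\Lambda$ and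 $r>0$, we say that there is R-tipping away from $X_-$ at rate $r$ if $\dot x=f(x,\Lambda(rt))$ has a unique maximal solution $x^r$ in $U$ that is defined for all sufficiently negative $t$ and satisfies $x^r(t)\to X_-$ as $t\to-\infty$ (the local pullback attractor to $X_-$), and it is not the case that $x^r$ is defined for all $t$ with $x^r(t)\to X_+$ as $t\to+\infty$. 1. Suppose that there is a stable path $(Y(s),\Lambda(s))$ whose limit $Y_+=\lim_{s\to+\infty}Y(s)$ exists, is an attracting equilibrium for $\lambda=\lambda_+$ and satisfies $Y_+\ne X_+$, and that there are $u<v$ with $X(u)\in\mathbb B(Y(v),\Lambda(v))$. Then $(X(s),\Lambda(s))$ is not FBS, and there is an increasing $C^2$ bijection $\sigma:\mathbb R\to\mathbb R$ with $\sigma'>0$ such that $\tilde\Lambda=\Lambda\circ\sigma$ is again a parameter shift from $\lambda_-$ to $\lambda_+$ and, for $\tilde\Lambda$ in place of $\Lambda$, there is R-tipping away from $X_-$ at some rate $r>0$. 2. Suppose that there is an attracting equilibrium $Y_+\ne X_+$ for $\lambda=\lambda_+$ with $X_-\in\mathbb B(Y_+,\lambda_+)$. Then $(X(s),\Lambda(s))$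 is not FBS, and there is $r_0>0$ such that for the given $\Lambda$ there is R-tipping away from $X_-$ at every rate $r>r_0$. -/

import Mathlib

open Set Filter Topology

namespace RateTipping

/-- `ℝⁿ` with its Euclidean norm. -/
abbrev Space (n : ℕ) : Type := EuclideanSpace ℝ (Fin n)

/-- `Λ` is a parameter shift from `lm` to `lp`: a `C²` function `ℝ → (lm, lp)` that tends to
`lm` at `-∞` and to `lp` at `+∞`, with derivative tending to `0` at both ends. -/
structure IsParameterShift (Λ : ℝ → ℝ) (lm lp : ℝ) : Prop where
  contDiff : ContDiff ℝ 2 Λ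
  mem_Ioo : ∀ s, Λ s ∈ Ioo lm lp
  tendsto_atBot : Tendsto Λ atBot (𝓝 lm)
  tendsto_atTop : Tendsto Λ atTop (𝓝 lp)
  deriv_atBot : Tendsto (deriv Λ) atBot (𝓝 0)
  deriv_atTop : Tendsto (deriv Λ) atTop (𝓝 0)

/-- `p ∈ U` is a (linearly) attracting equilibrium of `ẋ = f(x, l)`: `f(p, l) = 0` and every
complex eigenvalue of the Jacobian `∂ₓ f(p, l)` (every complex root of its characteristic
polynomial) has negative real part. -/
structure IsAttractingEquilibrium {n : ℕ} (U : Set (Space n)) (f : Space n → ℝ → Space n)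
    (l : ℝ) (p : Space n) : Prop where
  mem : p ∈ U
  eq_zero : f p l = 0
  re_neg : ∀ μ : ℂ,
    Polynomial.aeval μ
      (LinearMap.charpoly (fderiv ℝ (fun x => f x l) p : Space n →ₗ[ℝ] Space n)) = 0 →
    μ.re < 0

/-- The basin of attraction of `p` for the autonomous system `ẋ = f(x, l)` on `U`: the initial
points whose forward solution exists for all `t ≥ 0`, stays in `U` and converges to `p`. -/
def basin {n : ℕ} (U : Set (Space n)) (f : Space n → ℝ → Space n) (l : ℝ) (p : Space n) :
    Set (Space n) :=
  {a | ∃ x : ℝ → Space n, x 0 = a ∧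
    (∀ t : ℝ, 0 ≤ t → x t ∈ U ∧ HasDerivWithinAt x (f (x t) l) (Ici 0) t) ∧
    Tendsto x atTop (𝓝 p)}

/-- `(X(s), Λ(s))` is a stable path: `X` is continuous and each `X s` is an attracting equilibrium
of `ẋ = f(x, Λ s)`. -/
structure IsStablePath {n : ℕ} (U : Set (Space n)) (f : Space n → ℝ → Space n)
    (Λ : ℝ → ℝ) (X : ℝ → Space n) : Prop where
  continuous : Continuous X
  attracting : ∀ s, IsAttractingEquilibrium U f (Λ s) (X s)

/-- Forward basin stability of the path `(X(s), Λ(s))`. -/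
def IsForwardBasinStable {n : ℕ} (U : Set (Space n)) (f : Space n → ℝ → Space n)
    (Λ : ℝ → ℝ) (X : ℝ → Space n) : Prop :=
  ∀ s : ℝ, closure (X '' Iio s) ⊆ basin U f (Λ s) (X s)

/-- `x` solves `ẋ = f(x, Λ(r t))` in `U` on the time interval `(-∞, b)`, where `b ≤ +∞`. -/
def IsTrajectory {n : ℕ} (U : Set (Space n)) (f : Space n → ℝ → Space n)
    (Λ : ℝ → ℝ) (r : ℝ) (b : EReal) (x : ℝ → Space n) : Prop :=
  ∀ t : ℝ, (t : EReal) < b → x t ∈ U ∧ HasDerivAt x (f (x t) (Λ (r * t))) t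

/-- `x`, on its maximal interval of existence `(-∞, b)`, is the local pullback attractor to `Xm`
at rate `r`: the unique trajectory of `ẋ = f(x, Λ(r t))` that tends to `Xm` as `t → -∞`.
Maximality and uniqueness: every trajectory on some `(-∞, c)` that tends to `Xm` as `t → -∞`
is a restriction of `x`. -/
structure IsPullbackAttractor {n : ℕ} (U : Set (Space n)) (f : Space n → ℝ → Space n)
    (Λ : ℝ → ℝ) (r : ℝ) (Xm : Space n) (b : EReal) (x : ℝ → Space n) : Prop where
  bot_lt : ⊥ < b
  trajectory : IsTrajectory U f Λ r b x
  tendsto_atBot : Tendsto x atBot (𝓝 Xm)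
  unique : ∀ (c : EReal) (y : ℝ → Space n), IsTrajectory U f Λ r c y →
    Tendsto y atBot (𝓝 Xm) → c ≤ b ∧ ∀ t : ℝ, (t : EReal) < c → y t = x t

/-- R-tipping away from `Xm` at rate `r`, for a path ending at `Xp`: the local pullback attractor
to `Xm` exists (and is unique), and it does not converge to `Xp` as `t → +∞` (in particular this
is so when it is not defined for all times). -/
def RTips {n : ℕ} (U : Set (Space n)) (f : Space n → ℝ → Space n)
    (Λ : ℝ → ℝ) (r : ℝ) (Xm Xp : Space n) : Prop :=
  ∃ (b : EReal) (x : ℝ → Space n), IsPullbackAttractor U f Λ r Xm b x ∧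
    ¬ (b = ⊤ ∧ Tendsto x atTop (𝓝 Xp))

/-- An increasing `C²` reparametrization of the real line, with positive derivative. -/
structure IsReparametrization (σ : ℝ → ℝ) : Prop where
  contDiff : ContDiff ℝ 2 σ
  deriv_pos : ∀ s, 0 < deriv σ s
  tendsto_atBot : Tendsto σ atBot atBot
  tendsto_atTop : Tendsto σ atTop atTop

end RateTipping

/-!
Near an attracting equilibrium a quadratic form makes the field strictly dissipative, uniformly in
the nearby parameters. Solutions of the driven equation are therefore trapped there and contract
towards the equilibrium, which yields the pullback attractor and, for small rates, makes a solution
that starts near a stable path follow it. If tipping fails, the pullback attractor is defined for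
all times and ends at `X₊`.

For large `r` the parameter goes from near `λ₋` to near `λ₊` so fast that the pullback attractor is
still close to `X₋`; then `Y₊` captures it. For a stable path `Y`, let `σ` run at unit speed, except
that it jumps over `(u, v)` almost instantly. For small `r` the pullback attractor follows `X` up to
`X u`, is still there when the parameter has become `Λ v`, is captured by `Y v`, and follows `Y`
to `Y₊`.

Forward basin stability would put `X u` into the basins of both `X v` and `Y v`, so that `X` and `Y`
meet and, attracting equilibria being locally unique, coincide. It would also put `X₋` into the
basin of every `X s`, while for `Λ s` near `λ₊` the solution from `X₋` ends near `Y₊`.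
-/

namespace RateTipping

open scoped InnerProductSpace
open Metric

section Spectral

theorem tendsto_pow_zero_of_norm_spectrum_lt_one {𝔸 : Type*} [NormedRing 𝔸] [NormedAlgebra ℂ 𝔸]
    [CompleteSpace 𝔸] {a : 𝔸} (ha : ∀ z ∈ spectrum ℂ a, ‖z‖ < 1) :
    Tendsto (fun k => a ^ k) atTop (𝓝 0) := by
  nontriviality 𝔸
  have hrad : spectralRadius ℂ a < (1 : NNReal) :=
    spectrum.spectralRadius_lt_of_forall_lt a fun z hz => mod_cast ha z hz
  obtain ⟨q, hq, hq1⟩ := exists_between hrad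
  lift q to NNReal using (hq1.trans ENNReal.coe_lt_top).ne
  have hpow : ∀ᶠ k : ℕ in atTop, ‖a ^ k‖ ≤ (q : ℝ) ^ k := by
    have hlim := spectrum.pow_nnnorm_pow_one_div_tendsto_nhds_spectralRadius a
    filter_upwards [hlim.eventually_lt_const hq, eventually_gt_atTop 0] with k hk hk0
    have := ENNReal.rpow_le_rpow hk.le (Nat.cast_nonneg k)
    rw [← ENNReal.rpow_mul, one_div_mul_cancel (mod_cast hk0.ne'), ENNReal.rpow_one,
      ENNReal.rpow_natCast] at this
    exact_mod_cast this
  exact squeeze_zero_norm' hpow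
    (tendsto_pow_atTop_nhds_zero_of_lt_one q.coe_nonneg (mod_cast hq1))

theorem exists_tendsto_one_add_smul_pow_zero {𝔸 : Type*} [NormedRing 𝔸] [NormedAlgebra ℂ 𝔸]
    [CompleteSpace 𝔸] {a : 𝔸} (ha : ∀ z ∈ spectrum ℂ a, z.re < 0) :
    ∃ h : ℝ, 0 < h ∧ Tendsto (fun k => (1 + (h : ℂ) • a) ^ k) atTop (𝓝 0) := by
  have hcont : ContinuousOn (fun z : ℂ => Complex.normSq z / -z.re) (spectrum ℂ a) :=
    Complex.continuous_normSq.continuousOn.div Complex.continuous_re.neg.continuousOn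
      fun z hz => by linarith [ha z hz]
  obtain ⟨C, hC⟩ := (spectrum.isCompact a).bddAbove_image hcont
  obtain ⟨h, h0, hhC⟩ : ∃ h : ℝ, 0 < h ∧ h * C < 2 := by
    refine ⟨(|C| + 1)⁻¹, by positivity, ?_⟩
    rw [inv_mul_lt_iff₀ (by positivity)]
    linarith [le_abs_self C, abs_nonneg C]
  refine ⟨h, h0, tendsto_pow_zero_of_norm_spectrum_lt_one fun w hw => ?_⟩
  obtain ⟨z, hz, rfl⟩ : ∃ z ∈ spectrum ℂ a, 1 + h * z = w := by
    let u : ℂˣ := Units.mk0 (h : ℂ) (mod_cast h0.ne')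
    change w ∈ spectrum ℂ (1 + u • a) at hw
    rw [← map_one (algebraMap ℂ 𝔸), ← spectrum.singleton_add_eq, spectrum.unit_smul_eq_smul,
      Set.singleton_add] at hw
    obtain ⟨_, ⟨z, hz, rfl⟩, rfl⟩ := hw
    exact ⟨z, hz, rfl⟩
  have hre := ha z hz
  have hbound : Complex.normSq z ≤ C * -z.re := (div_le_iff₀ (by linarith)).1 (hC ⟨z, hz, rfl⟩)
  rw [← sq_lt_one_iff₀ (norm_nonneg _), Complex.sq_norm]
  calc Complex.normSq (1 + h * z) = 1 + h * (2 * z.re + h * Complex.normSq z) := by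
        simp only [Complex.normSq_apply, Complex.add_re, Complex.add_im, Complex.one_re,
          Complex.one_im, Complex.re_ofReal_mul, Complex.im_ofReal_mul]
        ring
    _ ≤ 1 + h * (2 * z.re + h * (C * -z.re)) := by gcongr
    _ = 1 + h * ((2 - h * C) * z.re) := by ring
    _ < 1 := by linarith [mul_neg_of_pos_of_neg h0 (mul_neg_of_pos_of_neg (sub_pos.2 hhC) hre)]

attribute [local instance] Matrix.linftyOpNormedRing Matrix.linftyOpNormedAlgebra in
theorem exists_tendsto_one_add_smul_pow_zero_of_charpoly {E : Type*} [NormedAddCommGroup E]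
    [NormedSpace ℝ E] [FiniteDimensional ℝ E] (A : E →L[ℝ] E)
    (hA : ∀ μ : ℂ, Polynomial.aeval μ (LinearMap.charpoly (A : E →ₗ[ℝ] E)) = 0 → μ.re < 0) :
    ∃ h : ℝ, 0 < h ∧ Tendsto (fun k : ℕ => (1 + h • A) ^ k) atTop (𝓝 0) := by
  let b := Module.finBasis ℝ E
  let toEnd : (E →L[ℝ] E) →ₐ[ℝ] Module.End ℝ E :=
    { ContinuousLinearMap.toLinearMapRingHom with commutes' := fun _ => rfl }
  let φ : (E →L[ℝ] E) →ₐ[ℝ] Matrix _ _ ℂ :=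
    (Algebra.ofId ℝ ℂ).mapMatrix.comp ((LinearMap.toMatrixAlgEquiv b).toAlgHom.comp toEnd)
  have hφ : Topology.IsClosedEmbedding φ.toLinearMap := by
    refine LinearMap.isClosedEmbedding_of_injective (LinearMap.ker_eq_bot.2 ?_)
    exact (Matrix.map_injective Complex.ofReal_injective).comp
      ((LinearMap.toMatrixAlgEquiv b).injective.comp ContinuousLinearMap.coe_injective)
  obtain ⟨h, h0, hlim⟩ := exists_tendsto_one_add_smul_pow_zero (a := φ A) fun z hz => by
    refine hA z ?_
    rw [Matrix.mem_spectrum_iff_isRoot_charpoly] at hz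
    have : (φ A).charpoly = (LinearMap.charpoly (A : E →ₗ[ℝ] E)).map (algebraMap ℝ ℂ) := by
      rw [← LinearMap.charpoly_toMatrix _ b, ← Matrix.charpoly_map]
      rfl
    rwa [this, Polynomial.IsRoot, Polynomial.eval_map_algebraMap] at hz
  have hφ_pow (k : ℕ) : φ ((1 + h • A) ^ k) = (1 + (h : ℂ) • φ A) ^ k := by simp
  rw [← map_zero φ] at hlim
  exact ⟨h, h0, hφ.tendsto_nhds_iff.2 (hlim.congr fun k => (hφ_pow k).symm)⟩

end Spectral

section Lyapunov

/-- The Lyapunov form is `x ↦ ‖S x‖ ^ 2`, for `S x` the tuple of the first `N`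
iterates of `x` under a power-contracting discretization `1 + h A`. -/
theorem exists_lyapunov {E : Type*} [NormedAddCommGroup E] [InnerProductSpace ℝ E]
    [FiniteDimensional ℝ E] (A : E →L[ℝ] E)
    (hA : ∀ μ : ℂ, Polynomial.aeval μ (LinearMap.charpoly (A : E →ₗ[ℝ] E)) = 0 → μ.re < 0) :
    ∃ (N : ℕ) (S : E →L[ℝ] PiLp 2 fun _ : Fin N => E) (c : ℝ), 0 < c ∧
      (∀ x, ‖x‖ ≤ ‖S x‖) ∧ ∀ x, ⟪S x, S (A x)⟫_ℝ ≤ -c * ‖x‖ ^ 2 := by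
  obtain ⟨h, h0, hlim⟩ := exists_tendsto_one_add_smul_pow_zero_of_charpoly A hA
  set B : E →L[ℝ] E := 1 + h • A with hB
  obtain ⟨N, hN, hN0⟩ := ((hlim.norm.eventually_lt_const
    (by norm_num : ‖(0 : E →L[ℝ] E)‖ < 1 / 2)).and (eventually_gt_atTop 0)).exists
  let S : E →L[ℝ] PiLp 2 fun _ : Fin N => E :=
    (PiLp.continuousLinearEquiv 2 ℝ fun _ : Fin N => E).symm ∘L
      ContinuousLinearMap.pi fun k : Fin N => B ^ (k : ℕ)
  have hS (x : E) : ‖S x‖ ^ 2 = ∑ k ∈ Finset.range N, ‖(B ^ k) x‖ ^ 2 := by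
    rw [PiLp.norm_sq_eq_of_L2, Finset.sum_range]
    rfl
  have hSB (x : E) : ‖S (B x)‖ ^ 2 + ‖x‖ ^ 2 = ‖S x‖ ^ 2 + ‖(B ^ N) x‖ ^ 2 := by
    have hshift (k : ℕ) : (B ^ k) (B x) = (B ^ (k + 1)) x := by rw [pow_succ]; rfl
    simp only [hS, hshift]
    rw [← Finset.sum_range_succ fun k => ‖(B ^ k) x‖ ^ 2, Finset.sum_range_succ', pow_zero]
    rfl
  refine ⟨N, S, 3 / (8 * h), by positivity, fun x => ?_, fun x => ?_⟩
  · have := Finset.single_le_sum (f := fun k => ‖(B ^ k) x‖ ^ 2) (fun _ _ => sq_nonneg _)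
      (Finset.mem_range.2 hN0)
    exact le_of_sq_le_sq (by simpa [hS] using this) (norm_nonneg _)
  · have hBN : ‖(B ^ N) x‖ ≤ 1 / 2 * ‖x‖ := (B ^ N).le_of_opNorm_le hN.le x
    have hexp : ‖S (B x)‖ ^ 2 = ‖S x‖ ^ 2 + 2 * h * ⟪S x, S (A x)⟫_ℝ + h ^ 2 * ‖S (A x)‖ ^ 2 := by
      have : S (B x) = S x + h • S (A x) := by simp [hB]
      rw [this, norm_add_sq_real, inner_smul_right, norm_smul, mul_pow, Real.norm_eq_abs, sq_abs]
      ring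
    have key : 2 * h * ⟪S x, S (A x)⟫_ℝ ≤ -(3 / 4) * ‖x‖ ^ 2 := by
      have := pow_le_pow_left₀ (norm_nonneg _) hBN 2
      nlinarith [hSB x, mul_nonneg (sq_nonneg h) (sq_nonneg ‖S (A x)‖)]
    calc ⟪S x, S (A x)⟫_ℝ = 2 * h * ⟪S x, S (A x)⟫_ℝ / (2 * h) := by field_simp
      _ ≤ -(3 / 4) * ‖x‖ ^ 2 / (2 * h) := by gcongr
      _ = -(3 / (8 * h)) * ‖x‖ ^ 2 := by ring

end Lyapunov

section EnergyEstimates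

variable {F : Type*} [NormedAddCommGroup F] [InnerProductSpace ℝ F] {u u' : ℝ → F} {a b : ℝ}

theorem norm_le_of_inner_deriv_neg {r : ℝ} (hu : ContinuousOn u (Icc a b))
    (hu' : ∀ t ∈ Ico a b, HasDerivWithinAt u (u' t) (Ici t) t) (hr : 0 ≤ r) (ha : ‖u a‖ ≤ r)
    (h : ∀ t ∈ Ico a b, ‖u t‖ = r → ⟪u t, u' t⟫_ℝ < 0) {t : ℝ} (ht : t ∈ Icc a b) : ‖u t‖ ≤ r := by
  refine le_of_sq_le_sq (image_le_of_deriv_right_lt_deriv_boundary (f := fun t => ‖u t‖ ^ 2)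
    (B := fun _ => r ^ 2) (hu.norm.pow 2) (fun t ht => (hu' t ht).norm_sq) (by gcongr)
    (fun _ => hasDerivAt_const _ _) (fun t ht hr' => ?_) ht) hr
  linarith [h t ht ((sq_eq_sq₀ (norm_nonneg _) hr).1 hr')]

theorem norm_sq_le_of_inner_deriv_le {κ e : ℝ} (hκ : 0 < κ) (hu : ContinuousOn u (Icc a b))
    (hu' : ∀ t ∈ Ico a b, HasDerivWithinAt u (u' t) (Ici t) t)
    (h : ∀ t ∈ Ico a b, ⟪u t, u' t⟫_ℝ ≤ -κ * ‖u t‖ ^ 2 + e * ‖u t‖) {t : ℝ} (ht : t ∈ Icc a b) :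
    ‖u t‖ ^ 2 ≤ ‖u a‖ ^ 2 * Real.exp (-κ * (t - a)) + (e / κ) ^ 2 := by
  have hbound := le_gronwallBound_of_liminf_deriv_right_le (f := fun t => ‖u t‖ ^ 2)
    (f' := fun t => 2 * ⟪u t, u' t⟫_ℝ) (δ := ‖u a‖ ^ 2) (K := -κ) (ε := e ^ 2 / κ) (hu.norm.pow 2)
    (fun t ht r hr => (hu' t ht).norm_sq.liminf_right_slope_le hr) le_rfl (fun t ht => ?_) t ht
  · rw [gronwallBound_of_K_ne_0 (neg_ne_zero.2 hκ.ne')] at hbound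
    calc ‖u t‖ ^ 2 ≤ ‖u a‖ ^ 2 * Real.exp (-κ * (t - a)) +
          e ^ 2 / κ / -κ * (Real.exp (-κ * (t - a)) - 1) := hbound
      _ = ‖u a‖ ^ 2 * Real.exp (-κ * (t - a)) +
          (e / κ) ^ 2 * (1 - Real.exp (-κ * (t - a))) := by field_simp; ring
      _ ≤ ‖u a‖ ^ 2 * Real.exp (-κ * (t - a)) + (e / κ) ^ 2 := by
          gcongr
          exact mul_le_of_le_one_right (sq_nonneg _) (sub_le_self _ (Real.exp_pos _).le)
  · have young : 2 * (e * ‖u t‖) ≤ κ * ‖u t‖ ^ 2 + e ^ 2 / κ := by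
      have : 0 ≤ (κ * ‖u t‖ - e) ^ 2 / κ := by positivity
      have : (κ * ‖u t‖ - e) ^ 2 / κ = κ * ‖u t‖ ^ 2 - 2 * (e * ‖u t‖) + e ^ 2 / κ := by
        field_simp
        ring
      linarith
    linarith [h t ht]

end EnergyEstimates

/-- The vector field of the nonautonomous equation `ẋ = f(x, μ(t))`. -/
abbrev drivenField {E P : Type*} (f : E → P → E) (μ : ℝ → P) : ℝ → E → E :=
  fun t x => f x (μ t)

theorem hasDerivWithinAt_Ici_of_isIntegralCurveOn {E : Type*} [NormedAddCommGroup E]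
    [NormedSpace ℝ E] {v : ℝ → E → E} {x : ℝ → E} {a b t : ℝ}
    (hx : IsIntegralCurveOn x v (Icc a b)) (ht : t ∈ Ico a b) :
    HasDerivWithinAt x (v t (x t)) (Ici t) t :=
  (hx t (Ico_subset_Icc_self ht)).mono_of_mem_nhdsWithin (Icc_mem_nhdsGE_of_mem ht)

/-- `f(·, m)` is, for all parameters `m` within `ρ` of `l`, strictly dissipative at rate `c` on the
`ρ`-ball around `p`, with respect to the inner product `⟪S x, S y⟫`. -/
structure IsDissipativeNear {E P F : Type*} [NormedAddCommGroup E] [NormedSpace ℝ E]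
    [PseudoMetricSpace P] [NormedAddCommGroup F] [InnerProductSpace ℝ F] (S : E →L[ℝ] F) (c ρ : ℝ)
    (f : E → P → E) (l : P) (p : E) : Prop where
  rate_pos : 0 < c
  radius_pos : 0 < ρ
  norm_le : ∀ x, ‖x‖ ≤ ‖S x‖
  inner_le : ∀ m ∈ closedBall l ρ, ∀ x ∈ closedBall p ρ, ∀ y ∈ closedBall p ρ,
    ⟪S (x - y), S (f x m - f y m)⟫_ℝ ≤ -c * ‖S (x - y)‖ ^ 2

namespace IsDissipativeNear

variable {E P F : Type*} [NormedAddCommGroup E] [NormedSpace ℝ E] [PseudoMetricSpace P]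
  [NormedAddCommGroup F] [InnerProductSpace ℝ F] {S : E →L[ℝ] F} {c ρ : ℝ} {f : E → P → E}
  {l : P} {p : E}

theorem mono (h : IsDissipativeNear S c ρ f l p) {ρ' : ℝ} (hρ' : 0 < ρ') (hle : ρ' ≤ ρ) :
    IsDissipativeNear S c ρ' f l p where
  __ := h
  radius_pos := hρ'
  inner_le m hm x hx y hy := h.inner_le m (closedBall_subset_closedBall hle hm)
    x (closedBall_subset_closedBall hle hx) y (closedBall_subset_closedBall hle hy)

theorem congr (h : IsDissipativeNear S c ρ f l p) {g : E → P → E}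
    (hfg : ∀ m ∈ closedBall l ρ, ∀ x ∈ closedBall p ρ, f x m = g x m) :
    IsDissipativeNear S c ρ g l p where
  __ := h
  inner_le m hm x hx y hy := by
    rw [← hfg m hm x hx, ← hfg m hm y hy]
    exact h.inner_le m hm x hx y hy

theorem eq_of_eq_zero (h : IsDissipativeNear S c ρ f l p) {m : P} (hm : m ∈ closedBall l ρ)
    {x y : E} (hx : x ∈ closedBall p ρ) (hy : y ∈ closedBall p ρ) (hfx : f x m = 0)
    (hfy : f y m = 0) : x = y := by
  have hin := h.inner_le m hm x hx y hy
  rw [hfx, hfy, sub_zero, map_zero, inner_zero_right] at hin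
  have hS : ‖S (x - y)‖ ^ 2 ≤ 0 := by nlinarith [h.rate_pos]
  have hS0 : ‖S (x - y)‖ = 0 := pow_eq_zero_iff two_ne_zero |>.1 (hS.antisymm (sq_nonneg _))
  exact sub_eq_zero.1 (norm_le_zero_iff.1 ((h.norm_le _).trans hS0.le))

theorem norm_sub_sq_le (h : IsDissipativeNear S c ρ f l p) {μ : ℝ → P} {x y y' : ℝ → E}
    {a b e : ℝ} (hab : a ≤ b) (hx : IsIntegralCurveOn x (drivenField f μ) (Icc a b))
    (hy : ContinuousOn y (Icc a b)) (hy' : ∀ t ∈ Ico a b, HasDerivWithinAt y (y' t) (Ici t) t)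
    (hμ : ∀ t ∈ Icc a b, μ t ∈ closedBall l ρ) (hxp : ∀ t ∈ Icc a b, x t ∈ closedBall p ρ)
    (hyp : ∀ t ∈ Icc a b, y t ∈ closedBall p ρ)
    (hdefect : ∀ t ∈ Icc a b, ‖S (f (y t) (μ t) - y' t)‖ ≤ e) :
    ‖x b - y b‖ ^ 2 ≤ (‖S‖ * ‖x a - y a‖) ^ 2 * Real.exp (-c * (b - a)) + (e / c) ^ 2 := by
  have henergy := norm_sq_le_of_inner_deriv_le (u := fun t => S (x t - y t))
    (u' := fun t => S (f (x t) (μ t) - y' t)) (e := e) h.rate_pos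
    (S.continuous.comp_continuousOn (hx.continuousOn.sub hy))
    (fun t ht => S.hasFDerivAt.comp_hasDerivWithinAt t
      ((hasDerivWithinAt_Ici_of_isIntegralCurveOn hx ht).sub (hy' t ht))) (fun t ht => ?_)
    (right_mem_Icc.2 hab)
  · calc ‖x b - y b‖ ^ 2 ≤ ‖S (x b - y b)‖ ^ 2 := by gcongr; exact h.norm_le _
      _ ≤ _ := henergy
      _ ≤ _ := by gcongr; exact S.le_opNorm _
  · have ht' := Ico_subset_Icc_self ht
    calc ⟪S (x t - y t), S (f (x t) (μ t) - y' t)⟫_ℝ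
        = ⟪S (x t - y t), S (f (x t) (μ t) - f (y t) (μ t))⟫_ℝ +
          ⟪S (x t - y t), S (f (y t) (μ t) - y' t)⟫_ℝ := by
          rw [← inner_add_right, ← map_add, sub_add_sub_cancel]
      _ ≤ -c * ‖S (x t - y t)‖ ^ 2 + ‖S (x t - y t)‖ * e := by
          refine add_le_add (h.inner_le _ (hμ t ht') _ (hxp t ht') _ (hyp t ht')) ?_
          refine (real_inner_le_norm _ _).trans ?_
          gcongr
          exact hdefect t ht'
      _ = _ := by rw [mul_comm e]

theorem norm_sub_sq_le_of_isIntegralCurveOn (h : IsDissipativeNear S c ρ f l p) {μ : ℝ → P}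
    {x y : ℝ → E} {a b : ℝ} (hab : a ≤ b) (hx : IsIntegralCurveOn x (drivenField f μ) (Icc a b))
    (hy : IsIntegralCurveOn y (drivenField f μ) (Icc a b))
    (hμ : ∀ t ∈ Icc a b, μ t ∈ closedBall l ρ) (hxp : ∀ t ∈ Icc a b, x t ∈ closedBall p ρ)
    (hyp : ∀ t ∈ Icc a b, y t ∈ closedBall p ρ) :
    ‖x b - y b‖ ^ 2 ≤ (‖S‖ * ‖x a - y a‖) ^ 2 * Real.exp (-c * (b - a)) := by
  simpa using h.norm_sub_sq_le (e := 0) hab hx hy.continuousOn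
    (fun t ht => hasDerivWithinAt_Ici_of_isIntegralCurveOn hy ht) hμ hxp hyp (by simp)

theorem mem_closedBall_of_isIntegralCurveOn (h : IsDissipativeNear S c ρ f l p) {μ : ℝ → P}
    {x : ℝ → E} {a b η : ℝ} (hη : 0 < η) (hηρ : η ≤ ρ)
    (hx : IsIntegralCurveOn x (drivenField f μ) (Icc a b)) (hxa : ‖S (x a - p)‖ ≤ η)
    (hμ : ∀ t ∈ Icc a b, μ t ∈ closedBall l ρ) (hf : ∀ t ∈ Icc a b, ‖S (f p (μ t))‖ < c * η)
    {t : ℝ} (ht : t ∈ Icc a b) : x t ∈ closedBall p η := by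
  rw [mem_closedBall_iff_norm]
  refine (h.norm_le _).trans (norm_le_of_inner_deriv_neg (u := fun t => S (x t - p))
    (u' := fun t => S (f (x t) (μ t)))
    (S.continuous.comp_continuousOn (hx.continuousOn.sub continuousOn_const))
    (fun t ht => S.hasFDerivAt.comp_hasDerivWithinAt t
      ((hasDerivWithinAt_Ici_of_isIntegralCurveOn hx ht).sub_const p))
    hη.le hxa (fun t ht hr => ?_) ht)
  have ht' := Ico_subset_Icc_self ht
  have hxt : x t ∈ closedBall p ρ :=
    mem_closedBall_iff_norm.2 ((h.norm_le _).trans (hr.le.trans hηρ))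
  calc ⟪S (x t - p), S (f (x t) (μ t))⟫_ℝ
      = ⟪S (x t - p), S (f (x t) (μ t) - f p (μ t))⟫_ℝ + ⟪S (x t - p), S (f p (μ t))⟫_ℝ := by
        rw [← inner_add_right, ← map_add, sub_add_cancel]
    _ ≤ -c * ‖S (x t - p)‖ ^ 2 + ‖S (x t - p)‖ * ‖S (f p (μ t))‖ :=
        add_le_add (h.inner_le _ (hμ t ht') _ hxt _ (mem_closedBall_self h.radius_pos.le))
          (real_inner_le_norm _ _)
    _ = η * (‖S (f p (μ t))‖ - c * η) := by rw [hr]; ring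
    _ < 0 := mul_neg_of_pos_of_neg hη (sub_neg.2 (hf t ht'))

theorem exists_trap (h : IsDissipativeNear S c ρ f l p) (hcont : ContinuousAt (f p) l)
    (hp : f p l = 0) {η : ℝ} (hη : 0 < η) :
    ∃ δ > 0, ∀ (μ : ℝ → P) (x : ℝ → E) (a b : ℝ),
      IsIntegralCurveOn x (drivenField f μ) (Icc a b) → (∀ t ∈ Icc a b, μ t ∈ closedBall l δ) →
      x a ∈ closedBall p δ → ∀ t ∈ Icc a b, x t ∈ closedBall p η := by
  obtain ⟨η', hη'0, hη'⟩ : ∃ η' > 0, η' ≤ ρ ∧ η' ≤ η :=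
    ⟨min ρ η, lt_min h.radius_pos hη, min_le_left _ _, min_le_right _ _⟩
  have hcη : 0 < c * η' := mul_pos h.rate_pos hη'0
  have hsmall : ∀ᶠ m in 𝓝 l, ‖S (f p m)‖ < c * η' :=
    (S.continuous.continuousAt.comp hcont).norm.eventually_lt_const (by simpa [hp] using hcη)
  have hstart : ∀ᶠ z in 𝓝 p, ‖S (z - p)‖ < η' :=
    (show Continuous fun z => ‖S (z - p)‖ by fun_prop).continuousAt.eventually_lt_const
      (by simpa using hη'0)
  obtain ⟨δ₁, hδ₁, h₁⟩ := nhds_basis_closedBall.eventually_iff.1 hsmall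
  obtain ⟨δ₂, hδ₂, h₂⟩ := nhds_basis_closedBall.eventually_iff.1 hstart
  refine ⟨min ρ (min δ₁ δ₂), lt_min h.radius_pos (lt_min hδ₁ hδ₂), fun μ x a b hx hμ hxa t ht => ?_⟩
  refine closedBall_subset_closedBall hη'.2 (h.mem_closedBall_of_isIntegralCurveOn hη'0 hη'.1 hx
    (h₂ ?_).le (fun s hs => ?_) (fun s hs => h₁ ?_) ht)
  · exact closedBall_subset_closedBall ((min_le_right _ _).trans (min_le_right _ _)) hxa
  · exact closedBall_subset_closedBall (min_le_left _ _) (hμ s hs)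
  · exact closedBall_subset_closedBall ((min_le_right _ _).trans (min_le_left _ _)) (hμ s hs)

theorem exists_relaxation (h : IsDissipativeNear S c ρ f l p) {q : E} (hq : q ∈ closedBall p ρ)
    {m : P} (hcont : ContinuousAt (f q) m) (hfq : f q m = 0) {ε : ℝ} (hε : 0 < ε) :
    ∃ δ > 0, ∃ T ≥ 0, ∀ (μ : ℝ → P) (x : ℝ → E) (a b : ℝ),
      IsIntegralCurveOn x (drivenField f μ) (Icc a b) →
      (∀ t ∈ Icc a b, μ t ∈ closedBall l ρ ∧ μ t ∈ closedBall m δ) →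
      (∀ t ∈ Icc a b, x t ∈ closedBall p ρ) → T ≤ b - a → x b ∈ closedBall q ε := by
  have hc := h.rate_pos
  have hsmall : ∀ᶠ m' in 𝓝 m, ‖S (f q m')‖ < c * (ε / 2) :=
    (S.continuous.continuousAt.comp hcont).norm.eventually_lt_const
      (by simp only [Function.comp_apply, hfq, map_zero, norm_zero]; positivity)
  obtain ⟨δ, hδ, hδm⟩ := nhds_basis_closedBall.eventually_iff.1 hsmall
  have hdecay : Tendsto (fun T => (‖S‖ * (2 * ρ)) ^ 2 * Real.exp (-c * T)) atTop (𝓝 0) := by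
    simpa using (Real.tendsto_exp_comp_nhds_zero.2
      (tendsto_id.const_mul_atTop_of_neg (neg_neg_of_pos hc))).const_mul ((‖S‖ * (2 * ρ)) ^ 2)
  obtain ⟨T, hT, hT0⟩ := ((hdecay.eventually_lt_const (show 0 < ε ^ 2 / 2 by positivity)).and
    (eventually_ge_atTop 0)).exists
  refine ⟨δ, hδ, T, hT0, fun μ x a b hx hμ hxp hT' => ?_⟩
  have hab : a ≤ b := sub_nonneg.1 (hT0.trans hT')
  have hdist : ‖x a - q‖ ≤ 2 * ρ := by
    rw [← dist_eq_norm, two_mul]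
    exact (dist_triangle_right _ _ p).trans (add_le_add (hxp a (left_mem_Icc.2 hab)) hq)
  rw [mem_closedBall_iff_norm]
  refine le_of_sq_le_sq ?_ hε.le
  calc ‖x b - q‖ ^ 2
      ≤ (‖S‖ * ‖x a - q‖) ^ 2 * Real.exp (-c * (b - a)) + (c * (ε / 2) / c) ^ 2 :=
        h.norm_sub_sq_le hab hx continuousOn_const (fun _ _ => hasDerivWithinAt_const _ _ _)
          (fun t ht => (hμ t ht).1) hxp (fun _ _ => hq)
          fun t ht => by rw [sub_zero]; exact (hδm (hμ t ht).2).le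
    _ ≤ (‖S‖ * (2 * ρ)) ^ 2 * Real.exp (-c * T) + (ε / 2) ^ 2 := by
        rw [mul_div_cancel_left₀ _ hc.ne', neg_mul, neg_mul]
        gcongr
    _ ≤ ε ^ 2 := by linarith [sq_nonneg ε]

end IsDissipativeNear

theorem exists_isDissipativeNear {E P : Type*} [NormedAddCommGroup E] [InnerProductSpace ℝ E]
    [FiniteDimensional ℝ E] [NormedAddCommGroup P] [NormedSpace ℝ P] {f : E → P → E} {l : P} {p : E}
    (hf : ContDiffAt ℝ 1 (Function.uncurry f) (p, l))
    (hneg : ∀ μ : ℂ, Polynomial.aeval μ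
      (LinearMap.charpoly (fderiv ℝ (fun x => f x l) p : E →ₗ[ℝ] E)) = 0 → μ.re < 0) :
    ∃ (N : ℕ) (S : E →L[ℝ] PiLp 2 fun _ : Fin N => E) (c ρ : ℝ), IsDissipativeNear S c ρ f l p := by
  set A := fderiv ℝ (fun x => f x l) p with hA
  obtain ⟨N, S, c, hc, hSnorm, hSA⟩ := exists_lyapunov A hneg
  have hε : 0 < c / 2 / (‖S‖ ^ 2 + 1) := by positivity
  have hstrict := hf.hasStrictFDerivAt one_ne_zero
  have hAf (z : E) : fderiv ℝ (Function.uncurry f) (p, l) (z, 0) = A z := by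
    rw [hA, show (fun x => f x l) = Function.uncurry f ∘ fun x => (x, l) from rfl,
      (hstrict.hasFDerivAt.comp p (hasFDerivAt_prodMk_left (𝕜 := ℝ) p l)).fderiv]
    rfl
  obtain ⟨ρ, hρ, hclose⟩ := nhds_basis_closedBall.eventually_iff.1 (hstrict.isLittleO.def hε)
  refine ⟨N, S, c / 2 / (‖S‖ ^ 2 + 1), ρ, hε, hρ, hSnorm, fun m hm x hx y hy => ?_⟩
  have hlin : ‖f x m - f y m - A (x - y)‖ ≤ c / 2 / (‖S‖ ^ 2 + 1) * ‖x - y‖ := by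
    have := @hclose ((x, m), (y, m)) (by simp_all [Prod.dist_eq])
    simpa [hAf, Prod.norm_def] using this
  calc ⟪S (x - y), S (f x m - f y m)⟫_ℝ
      = ⟪S (x - y), S (A (x - y))⟫_ℝ + ⟪S (x - y), S (f x m - f y m - A (x - y))⟫_ℝ := by
        rw [← inner_add_right, ← map_add, add_sub_cancel]
    _ ≤ -c * ‖x - y‖ ^ 2 + (‖S‖ * ‖x - y‖) * (‖S‖ * (c / 2 / (‖S‖ ^ 2 + 1) * ‖x - y‖)) := by
        refine add_le_add (hSA _) ((real_inner_le_norm _ _).trans ?_)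
        gcongr
        · exact S.le_opNorm _
        · exact S.le_opNorm_of_le hlin
    _ = -(c / 2 / (‖S‖ ^ 2 + 1)) * ((‖S‖ ^ 2 + 2) * ‖x - y‖ ^ 2) := by field_simp; ring
    _ ≤ -(c / 2 / (‖S‖ ^ 2 + 1)) * ‖S (x - y)‖ ^ 2 := by
        refine mul_le_mul_of_nonpos_left ?_ (neg_nonpos.2 hε.le)
        calc ‖S (x - y)‖ ^ 2 ≤ (‖S‖ * ‖x - y‖) ^ 2 := by gcongr; exact S.le_opNorm _
          _ ≤ (‖S‖ ^ 2 + 2) * ‖x - y‖ ^ 2 := by nlinarith [sq_nonneg ‖x - y‖]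

theorem norm_sub_le_mul_exp {E P : Type*} [NormedAddCommGroup E] [NormedSpace ℝ E]
    [PseudoMetricSpace P] {f : E → P → E} {L : NNReal} {K : Set E} {J : Set P}
    (hL : LipschitzOnWith L (Function.uncurry f) (K ×ˢ J)) {μ ν : ℝ → P} {x y : ℝ → E} {a b δ : ℝ}
    (hδ : 0 < δ) (hx : IsIntegralCurveOn x (drivenField f μ) (Icc a b))
    (hy : IsIntegralCurveOn y (drivenField f ν) (Icc a b)) (hμ : ∀ t ∈ Icc a b, μ t ∈ J)
    (hν : ∀ t ∈ Icc a b, ν t ∈ J) (hμν : ∀ t ∈ Icc a b, dist (μ t) (ν t) ≤ δ)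
    (hyK : ∀ t ∈ Icc a b, closedBall (y t) (δ * Real.exp ((L + 1) * (t - a))) ⊆ K)
    (hxy : ‖x a - y a‖ ≤ δ) {t : ℝ} (ht : t ∈ Icc a b) :
    ‖x t - y t‖ ≤ δ * Real.exp ((L + 1) * (t - a)) := by
  refine image_norm_le_of_norm_deriv_right_lt_deriv_boundary (f := fun t => x t - y t)
    (f' := fun t => f (x t) (μ t) - f (y t) (ν t))
    (B := fun t => δ * Real.exp ((L + 1) * (t - a)))
    (B' := fun t => (L + 1) * (δ * Real.exp ((L + 1) * (t - a))))
    (hx.continuousOn.sub hy.continuousOn)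
    (fun t ht => (hasDerivWithinAt_Ici_of_isIntegralCurveOn hx ht).sub
      (hasDerivWithinAt_Ici_of_isIntegralCurveOn hy ht)) (by simpa using hxy)
    (fun t => ?_) (fun t ht hB => ?_) ht
  · exact ((((hasDerivAt_id t).sub_const a).const_mul ((L : ℝ) + 1)).exp.const_mul δ).congr_deriv
      (by simp only [id_eq]; ring)
  · have ht' := Ico_subset_Icc_self ht
    set B := δ * Real.exp ((L + 1) * (t - a))
    have hB0 : 0 < B := by positivity
    have hδB : δ ≤ B := le_mul_of_one_le_right hδ.le
      (Real.one_le_exp (mul_nonneg (by positivity) (sub_nonneg.2 ht.1)))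
    calc ‖f (x t) (μ t) - f (y t) (ν t)‖ ≤ L * dist (x t, μ t) (y t, ν t) := by
          rw [← dist_eq_norm]
          exact hL.dist_le_mul (x t, μ t)
            ⟨hyK t ht' (mem_closedBall_iff_norm.2 hB.le), hμ t ht'⟩ (y t, ν t)
            ⟨hyK t ht' (mem_closedBall_self hB0.le), hν t ht'⟩
      _ ≤ L * B := by
          rw [Prod.dist_eq]
          gcongr
          exact max_le ((dist_eq_norm _ _).trans hB).le ((hμν t ht').trans hδB)
      _ < (L + 1) * B := by linarith

section SmoothFields

variable {E P : Type*} [NormedAddCommGroup E] [NormedSpace ℝ E] [NormedAddCommGroup P]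
  [NormedSpace ℝ P] {U : Set E} {f : E → P → E}

theorem locallyLipschitzOn_of_contDiffOn {G : Type*} [NormedAddCommGroup G] [NormedSpace ℝ G]
    {φ : E → G} (hU : IsOpen U) (hφ : ContDiffOn ℝ 1 φ U) : LocallyLipschitzOn U φ := by
  intro x hx
  obtain ⟨K, t, ht, hK⟩ := (hφ.contDiffAt (hU.mem_nhds hx)).exists_lipschitzOnWith
  exact ⟨K, t, mem_nhdsWithin_of_mem_nhds ht, hK⟩

theorem exists_lipschitzOnWith_of_isCompact (hU : IsOpen U)
    (hf : ContDiffOn ℝ 1 (Function.uncurry f) (U ×ˢ univ)) {K : Set E} (hK : IsCompact K)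
    (hKU : K ⊆ U) {J : Set P} (hJ : IsCompact J) :
    ∃ L, LipschitzOnWith L (Function.uncurry f) (K ×ˢ J) :=
  ((locallyLipschitzOn_of_contDiffOn (hU.prod isOpen_univ) hf).mono
    (prod_mono hKU (subset_univ J))).exists_lipschitzOnWith_of_compact (hK.prod hJ)

theorem continuous_apply_of_contDiffOn (hf : ContDiffOn ℝ 1 (Function.uncurry f) (U ×ˢ univ))
    {q : E} (hq : q ∈ U) : Continuous (f q) :=
  hf.continuousOn.comp_continuous (Continuous.prodMk_right q) fun m => ⟨hq, mem_univ m⟩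

theorem eqOn_of_isIntegralCurveOn (hU : IsOpen U)
    (hf : ContDiffOn ℝ 1 (Function.uncurry f) (U ×ˢ univ)) {μ : ℝ → P} {x y : ℝ → E} {a b : ℝ}
    (hμ : ContinuousOn μ (Icc a b)) (hx : IsIntegralCurveOn x (drivenField f μ) (Icc a b))
    (hxU : ∀ t ∈ Icc a b, x t ∈ U) (hy : IsIntegralCurveOn y (drivenField f μ) (Icc a b))
    (hyU : ∀ t ∈ Icc a b, y t ∈ U) (hxy : x a = y a) : EqOn x y (Icc a b) := by
  obtain ⟨L, hL⟩ := exists_lipschitzOnWith_of_isCompact hU hf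
    (K := x '' Icc a b ∪ y '' Icc a b) (J := μ '' Icc a b)
    ((isCompact_Icc.image_of_continuousOn hx.continuousOn).union
      (isCompact_Icc.image_of_continuousOn hy.continuousOn))
    (union_subset (image_subset_iff.2 hxU) (image_subset_iff.2 hyU))
    (isCompact_Icc.image_of_continuousOn hμ)
  refine ODE_solution_unique_of_mem_Icc_right (v := drivenField f μ) (K := L)
    (s := fun _ => x '' Icc a b ∪ y '' Icc a b) (fun t ht => ?_) hx.continuousOn
    (fun t ht => hasDerivWithinAt_Ici_of_isIntegralCurveOn hx ht)
    (fun t ht => Or.inl (mem_image_of_mem x (Ico_subset_Icc_self ht))) hy.continuousOn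
    (fun t ht => hasDerivWithinAt_Ici_of_isIntegralCurveOn hy ht)
    (fun t ht => Or.inr (mem_image_of_mem y (Ico_subset_Icc_self ht))) hxy
  have := hL.comp (LipschitzWith.prodMk_right (μ t)).lipschitzOnWith
    fun z hz => ⟨hz, mem_image_of_mem μ (Ico_subset_Icc_self ht)⟩
  rwa [mul_one] at this

theorem exists_mem_closedBall_of_short_time [LocallyCompactSpace E] (hU : IsOpen U)
    (hf : ContDiffOn ℝ 1 (Function.uncurry f) (U ×ˢ univ)) {q : E} (hq : q ∈ U) {J : Set P}
    (hJ : IsCompact J) {ε : ℝ} (hε : 0 < ε) :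
    ∃ δ > 0, ∀ (μ : ℝ → P) (x : ℝ → E) (a b : ℝ),
      IsIntegralCurveOn x (drivenField f μ) (Icc a b) → (∀ t ∈ Icc a b, μ t ∈ J) →
      x a ∈ closedBall q δ → b - a ≤ δ → ∀ t ∈ Icc a b, x t ∈ closedBall q ε := by
  obtain ⟨K, hK, hqK, hKU⟩ := exists_compact_subset hU hq
  obtain ⟨ρ, hρ, hρK⟩ := nhds_basis_closedBall.mem_iff.1 (isOpen_interior.mem_nhds hqK)
  obtain ⟨M, hM⟩ := (hK.prod hJ).exists_bound_of_continuousOn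
    (hf.continuousOn.mono (prod_mono hKU (subset_univ J)))
  have hM0 : 0 < |M| + 2 := by positivity
  let η := min ε ρ
  have hη : 0 < η := lt_min hε hρ
  refine ⟨η / (|M| + 2), div_pos hη hM0, fun μ x a b hx hμ hxa hab t ht => ?_⟩
  have hfence : ∀ t ∈ Icc a b, η / (|M| + 2) + (|M| + 1) * (t - a) ≤ η := fun t ht =>
    calc η / (|M| + 2) + (|M| + 1) * (t - a)
        ≤ η / (|M| + 2) + (|M| + 1) * (η / (|M| + 2)) := by gcongr; linarith [ht.2]
      _ = η := by field_simp; ring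
  rw [mem_closedBall_iff_norm] at hxa ⊢
  refine (image_norm_le_of_norm_deriv_right_lt_deriv_boundary (f := fun t => x t - q)
    (f' := fun t => f (x t) (μ t)) (B := fun t => η / (|M| + 2) + (|M| + 1) * (t - a))
    (B' := fun _ => |M| + 1) (hx.continuousOn.sub continuousOn_const)
    (fun t ht => (hasDerivWithinAt_Ici_of_isIntegralCurveOn hx ht).sub_const q) (by simpa using hxa)
    (fun t => by
      simpa using
        (((hasDerivAt_id t).sub_const a).const_mul (|M| + 1)).const_add (η / (|M| + 2)))
    (fun t ht hB => ?_) ht).trans ((hfence t ht).trans (min_le_left _ _))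
  have ht' := Ico_subset_Icc_self ht
  have hxK : x t ∈ K := interior_subset <| hρK <| mem_closedBall_iff_norm.2 <|
    hB.le.trans ((hfence t ht').trans (min_le_right _ _))
  linarith [hM (x t, μ t) ⟨hxK, hμ t ht'⟩, le_abs_self M, show ‖f (x t) (μ t)‖ =
    ‖Function.uncurry f (x t, μ t)‖ from rfl]

theorem exists_shadowing [LocallyCompactSpace E] [LocallyCompactSpace P] (hU : IsOpen U)
    (hf : ContDiffOn ℝ 1 (Function.uncurry f) (U ×ˢ univ)) {z : ℝ → E} {l : P} {T : ℝ}
    (hz : IsIntegralCurveOn z (drivenField f fun _ => l) (Icc 0 T)) (hzU : ∀ t ∈ Icc 0 T, z t ∈ U)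
    {ε : ℝ} (hε : 0 < ε) :
    ∃ δ > 0, ∀ (μ : ℝ → P) (x : ℝ → E) (a : ℝ),
      IsIntegralCurveOn x (drivenField f μ) (Icc a (a + T)) →
      (∀ t ∈ Icc a (a + T), μ t ∈ closedBall l δ) →
      x a ∈ closedBall (z 0) δ → ∀ t ∈ Icc a (a + T), x t ∈ closedBall (z (t - a)) ε := by
  have hzK : IsCompact (z '' Icc 0 T) := isCompact_Icc.image_of_continuousOn hz.continuousOn
  obtain ⟨K, hK, hKz, hKU⟩ := exists_compact_between hzK hU (image_subset_iff.2 hzU)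
  obtain ⟨ρ, hρ, hρK⟩ := hzK.exists_cthickening_subset_open isOpen_interior hKz
  obtain ⟨J, hJ, hlJ⟩ := exists_compact_mem_nhds l
  obtain ⟨ρ', hρ', hρJ⟩ := nhds_basis_closedBall.mem_iff.1 hlJ
  obtain ⟨L, hL⟩ := exists_lipschitzOnWith_of_isCompact hU hf hK hKU hJ
  let δ₀ := min ε ρ / Real.exp ((L + 1) * T)
  have hδ₀ : 0 < δ₀ := div_pos (lt_min hε hρ) (Real.exp_pos _)
  refine ⟨min δ₀ ρ', lt_min hδ₀ hρ', fun μ x a hx hμ hxa t ht => ?_⟩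
  have hfence : ∀ t ∈ Icc a (a + T), δ₀ * Real.exp ((L + 1) * (t - a)) ≤ min ε ρ := fun t ht =>
    calc δ₀ * Real.exp ((L + 1) * (t - a)) ≤ δ₀ * Real.exp ((L + 1) * T) := by
          gcongr; linarith [ht.2]
      _ = min ε ρ := div_mul_cancel₀ _ (Real.exp_ne_zero _)
  have hz' : ∀ t ∈ Icc a (a + T), t - a ∈ Icc 0 T := fun t ht =>
    ⟨sub_nonneg.2 ht.1, sub_le_iff_le_add'.2 ht.2⟩
  have hshift : IsIntegralCurveOn (fun t => z (t - a)) (drivenField f fun _ => l) (Icc a (a + T)) :=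
    (hz.comp_sub a).mono fun t ht => ⟨t - a, hz' t ht, add_sub_cancel a t⟩
  have := norm_sub_le_mul_exp hL hδ₀ hx hshift
    (fun t ht => hρJ (closedBall_subset_closedBall (min_le_right _ _) (hμ t ht)))
    (fun _ _ => mem_of_mem_nhds hlJ) (fun t ht => (hμ t ht).trans (min_le_left _ _))
    (fun s hs w hw => interior_subset (hρK ?_))
    (by simpa [← dist_eq_norm] using mem_closedBall.1 hxa |>.trans (min_le_left _ _)) ht
  · rw [mem_closedBall_iff_norm]
    exact this.trans ((hfence t ht).trans (min_le_left _ _))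
  · exact mem_cthickening_of_dist_le w _ ρ _ (mem_image_of_mem z (hz' s hs))
      ((mem_closedBall.1 hw).trans ((hfence s hs).trans (min_le_right _ _)))

end SmoothFields

section Equilibria

variable {n : ℕ} {U : Set (Space n)} {f : Space n → ℝ → Space n} {l : ℝ} {p q : Space n}

theorem IsAttractingEquilibrium.exists_isDissipativeNear (hp : IsAttractingEquilibrium U f l p)
    (hU : IsOpen U) (hf : ContDiffOn ℝ 1 (Function.uncurry f) (U ×ˢ univ)) :
    ∃ (N : ℕ) (S : Space n →L[ℝ] PiLp 2 fun _ : Fin N => Space n) (c ρ : ℝ),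
      IsDissipativeNear S c ρ f l p :=
  RateTipping.exists_isDissipativeNear
    (hf.contDiffAt ((hU.prod isOpen_univ).mem_nhds ⟨hp.mem, mem_univ l⟩)) hp.re_neg

theorem IsAttractingEquilibrium.exists_trap (hp : IsAttractingEquilibrium U f l p)
    (hU : IsOpen U) (hf : ContDiffOn ℝ 1 (Function.uncurry f) (U ×ˢ univ)) {η : ℝ} (hη : 0 < η) :
    ∃ δ > 0, ∀ (μ : ℝ → ℝ) (x : ℝ → Space n) (a b : ℝ),
      IsIntegralCurveOn x (drivenField f μ) (Icc a b) → (∀ t ∈ Icc a b, μ t ∈ closedBall l δ) →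
      x a ∈ closedBall p δ → ∀ t ∈ Icc a b, x t ∈ closedBall p η :=
  have ⟨_, _, _, _, h⟩ := hp.exists_isDissipativeNear hU hf
  h.exists_trap (continuous_apply_of_contDiffOn hf hp.mem).continuousAt hp.eq_zero hη

theorem IsAttractingEquilibrium.exists_trap_Iic (hp : IsAttractingEquilibrium U f l p)
    (hU : IsOpen U) (hf : ContDiffOn ℝ 1 (Function.uncurry f) (U ×ˢ univ)) {η : ℝ} (hη : 0 < η) :
    ∃ δ > 0, ∀ (μ : ℝ → ℝ) (x : ℝ → Space n) (b : ℝ),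
      IsIntegralCurveOn x (drivenField f μ) (Iic b) → (∀ t ≤ b, μ t ∈ closedBall l δ) →
      Tendsto x atBot (𝓝 p) → ∀ t ≤ b, x t ∈ closedBall p η := by
  obtain ⟨δ, hδ, h⟩ := hp.exists_trap hU hf hη
  refine ⟨δ, hδ, fun μ x b hx hμ hlim t ht => ?_⟩
  obtain ⟨a, ha, hat⟩ := ((hlim.eventually_mem (closedBall_mem_nhds p hδ)).and
    (eventually_le_atBot t)).exists
  exact h μ x a b (hx.mono Icc_subset_Iic_self) (fun s hs => hμ s hs.2) ha t ⟨hat, ht⟩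

theorem IsAttractingEquilibrium.exists_relaxation (hp : IsAttractingEquilibrium U f l p)
    (hU : IsOpen U) (hf : ContDiffOn ℝ 1 (Function.uncurry f) (U ×ˢ univ)) :
    ∃ ρ > 0, ∀ q ∈ closedBall p ρ, ∀ m, f q m = 0 → ∀ ε > 0, ∃ δ > 0, ∃ T ≥ 0,
      ∀ (μ : ℝ → ℝ) (x : ℝ → Space n) (a b : ℝ),
        IsIntegralCurveOn x (drivenField f μ) (Icc a b) →
        (∀ t ∈ Icc a b, μ t ∈ closedBall l ρ ∧ μ t ∈ closedBall m δ) →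
        (∀ t ∈ Icc a b, x t ∈ closedBall p ρ) → T ≤ b - a → x b ∈ closedBall q ε := by
  obtain ⟨_, _, _, ρ, h⟩ := hp.exists_isDissipativeNear hU hf
  obtain ⟨ρ', hρ', hρU⟩ := nhds_basis_closedBall.mem_iff.1 (hU.mem_nhds hp.mem)
  have h' := h.mono (lt_min h.radius_pos hρ') (min_le_left _ _)
  refine ⟨min ρ ρ', h'.radius_pos, fun q hq m hfq ε hε => h'.exists_relaxation hq ?_ hfq hε⟩
  exact (continuous_apply_of_contDiffOn hf
    (hρU (closedBall_subset_closedBall (min_le_right _ _) hq))).continuousAt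

theorem IsAttractingEquilibrium.exists_forall_eq (hp : IsAttractingEquilibrium U f l p)
    (hU : IsOpen U) (hf : ContDiffOn ℝ 1 (Function.uncurry f) (U ×ˢ univ)) :
    ∃ ρ > 0, ∀ m ∈ closedBall l ρ, ∀ x ∈ closedBall p ρ, ∀ y ∈ closedBall p ρ,
      f x m = 0 → f y m = 0 → x = y :=
  have ⟨_, _, _, ρ, h⟩ := hp.exists_isDissipativeNear hU hf
  ⟨ρ, h.radius_pos, fun _ hm _ hx _ hy => h.eq_of_eq_zero hm hx hy⟩

theorem IsAttractingEquilibrium.exists_capture (hp : IsAttractingEquilibrium U f l p)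
    (hU : IsOpen U) (hf : ContDiffOn ℝ 1 (Function.uncurry f) (U ×ˢ univ)) (hq : q ∈ basin U f l p)
    {ε : ℝ} (hε : 0 < ε) :
    ∃ δ > 0, ∃ T, ∀ (μ : ℝ → ℝ) (x : ℝ → Space n) (a b : ℝ),
      IsIntegralCurveOn x (drivenField f μ) (Icc a b) → (∀ t ∈ Icc a b, μ t ∈ closedBall l δ) →
      x a ∈ closedBall q δ → T ≤ b - a → x b ∈ closedBall p ε := by
  obtain ⟨z, rfl, hz, hlim⟩ := hq
  obtain ⟨ρ, hρ, hrelax⟩ := hp.exists_relaxation hU hf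
  obtain ⟨δ₁, hδ₁, T₁, hT₁, hrelax⟩ :=
    hrelax p (mem_closedBall_self hρ.le) l hp.eq_zero ε hε
  obtain ⟨δ₂, hδ₂, htrap⟩ := hp.exists_trap hU hf hρ
  obtain ⟨T₀, hT₀, hzT₀⟩ := ((eventually_ge_atTop 0).and
    (hlim.eventually_mem (closedBall_mem_nhds p (half_pos hδ₂)))).exists
  obtain ⟨δ₃, hδ₃, hshadow⟩ := exists_shadowing (T := T₀) hU hf
    (fun t ht => (hz t ht.1).2.mono Icc_subset_Ici_self) (fun t ht => (hz t ht.1).1) (half_pos hδ₂)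
  obtain ⟨δ, hδ, hδρ, hδδ₁, hδδ₂, hδδ₃⟩ : ∃ δ > 0, δ ≤ ρ ∧ δ ≤ δ₁ ∧ δ ≤ δ₂ ∧ δ ≤ δ₃ :=
    ⟨min (min ρ δ₁) (min δ₂ δ₃), by positivity, by simp, by simp, by simp, by simp⟩
  refine ⟨δ, hδ, T₀ + T₁, fun μ x a b hx hμ hxa hT => ?_⟩
  have hafter : Icc (a + T₀) b ⊆ Icc a b := Icc_subset_Icc_left (by linarith)
  have hmeet : x (a + T₀) ∈ closedBall p δ₂ := by
    have hsub : Icc a (a + T₀) ⊆ Icc a b := Icc_subset_Icc_right (by linarith)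
    have := hshadow μ x a (hx.mono hsub)
      (fun t ht => closedBall_subset_closedBall hδδ₃ (hμ t (hsub ht)))
      (closedBall_subset_closedBall hδδ₃ hxa) (a + T₀) (right_mem_Icc.2 (by linarith))
    rw [add_sub_cancel_left] at this
    exact closedBall_subset_closedBall' (by linarith [mem_closedBall.1 hzT₀]) this
  have hstay := htrap μ x (a + T₀) b (hx.mono hafter)
    (fun t ht => closedBall_subset_closedBall hδδ₂ (hμ t (hafter ht))) hmeet
  exact hrelax μ x (a + T₀) b (hx.mono hafter)
    (fun t ht => ⟨closedBall_subset_closedBall hδρ (hμ t (hafter ht)),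
      closedBall_subset_closedBall hδδ₁ (hμ t (hafter ht))⟩) hstay (by linarith)

theorem eq_of_mem_basin {p' : Space n} (hU : IsOpen U)
    (hf : ContDiffOn ℝ 1 (Function.uncurry f) (U ×ˢ univ)) (hp : q ∈ basin U f l p)
    (hp' : q ∈ basin U f l p') : p = p' := by
  obtain ⟨x, hx0, hx, hxlim⟩ := hp
  obtain ⟨y, hy0, hy, hylim⟩ := hp'
  refine tendsto_nhds_unique hxlim (hylim.congr' ?_)
  filter_upwards [eventually_ge_atTop 0] with t ht
  exact eqOn_of_isIntegralCurveOn (μ := fun _ => l) hU hf continuousOn_const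
    (fun s hs => (hy s hs.1).2.mono Icc_subset_Ici_self) (fun s hs => (hy s hs.1).1)
    (fun s hs => (hx s hs.1).2.mono Icc_subset_Ici_self) (fun s hs => (hx s hs.1).1)
    (hy0.trans hx0.symm) (right_mem_Icc.2 ht)

end Equilibria

section StablePaths

variable {n : ℕ} {U : Set (Space n)} {f : Space n → ℝ → Space n} {Λ : ℝ → ℝ}
  {X Y : ℝ → Space n}

theorem IsStablePath.comp_add (hX : IsStablePath U f Λ X) (s : ℝ) :
    IsStablePath U f (fun t => Λ (s + t)) fun t => X (s + t) :=
  ⟨hX.continuous.comp (continuous_const_add s), fun t => hX.attracting (s + t)⟩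

theorem IsStablePath.eq_of_apply_eq (hX : IsStablePath U f Λ X) (hY : IsStablePath U f Λ Y)
    (hU : IsOpen U) (hf : ContDiffOn ℝ 1 (Function.uncurry f) (U ×ˢ univ)) (hΛ : Continuous Λ)
    {s : ℝ} (hs : X s = Y s) : X = Y := by
  have hclopen : IsClopen {t | X t = Y t} := by
    refine ⟨isClosed_eq hX.continuous hY.continuous, isOpen_iff_mem_nhds.2 fun t ht => ?_⟩
    have ht : X t = Y t := ht
    obtain ⟨ρ, hρ, heq⟩ := (hX.attracting t).exists_forall_eq hU hf
    filter_upwards [hΛ.continuousAt.eventually_mem (closedBall_mem_nhds _ hρ),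
      hX.continuous.continuousAt.eventually_mem (closedBall_mem_nhds _ hρ),
      hY.continuous.continuousAt.eventually_mem (closedBall_mem_nhds _ hρ)]
      with t' hΛt hXt hYt
    exact heq _ hΛt _ hXt _ (by rwa [ht]) (hX.attracting t').eq_zero (hY.attracting t').eq_zero
  exact funext (eq_univ_iff_forall.1 (hclopen.eq_univ ⟨s, hs⟩))

theorem IsForwardBasinStable.eq_of_mem_basin (hFBS : IsForwardBasinStable U f Λ X)
    (hX : IsStablePath U f Λ X) (hY : IsStablePath U f Λ Y) (hU : IsOpen U)
    (hf : ContDiffOn ℝ 1 (Function.uncurry f) (U ×ˢ univ)) (hΛ : Continuous Λ) {u v : ℝ}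
    (huv : u < v) (hu : X u ∈ basin U f (Λ v) (Y v)) : X = Y :=
  hX.eq_of_apply_eq hY hU hf hΛ
    (RateTipping.eq_of_mem_basin hU hf (hFBS v (subset_closure (mem_image_of_mem X huv))) hu)

theorem IsForwardBasinStable.eq_of_lim_mem_basin (hFBS : IsForwardBasinStable U f Λ X)
    (hU : IsOpen U) (hf : ContDiffOn ℝ 1 (Function.uncurry f) (U ×ˢ univ)) {lp : ℝ}
    {Xm Xp Yp : Space n} (hΛ : Tendsto Λ atTop (𝓝 lp)) (hXm : Tendsto X atBot (𝓝 Xm))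
    (hXp : Tendsto X atTop (𝓝 Xp)) (hYp : IsAttractingEquilibrium U f lp Yp)
    (hXmYp : Xm ∈ basin U f lp Yp) : Xp = Yp := by
  have hXm_mem (s : ℝ) : Xm ∈ basin U f (Λ s) (X s) :=
    hFBS s (mem_closure_of_tendsto hXm
      ((eventually_lt_atBot s).mono fun _ h => mem_image_of_mem X h))
  refine tendsto_nhds_unique hXp (nhds_basis_closedBall.tendsto_right_iff.2 fun ε hε => ?_)
  obtain ⟨δ, hδ, T, hcapture⟩ := hYp.exists_capture hU hf hXmYp hε
  filter_upwards [hΛ.eventually_mem (closedBall_mem_nhds lp hδ)] with s hs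
  obtain ⟨z, hz0, hz, hzlim⟩ := hXm_mem s
  refine isClosed_closedBall.mem_of_tendsto hzlim ?_
  filter_upwards [eventually_ge_atTop T] with t ht
  exact hcapture (fun _ => Λ s) z 0 t (fun τ hτ => (hz τ hτ.1).2.mono Icc_subset_Ici_self)
    (fun _ _ => hs) (hz0 ▸ mem_closedBall_self hδ.le) (by linarith)

end StablePaths

section PullbackSolutions

variable {E : Type*} [NormedAddCommGroup E] [NormedSpace ℝ E]

theorem exists_isIntegralCurveOn_of_lipschitzWith [CompleteSpace E] {v : ℝ → E → E} {L : NNReal}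
    {M : ℝ} (hL : ∀ t, LipschitzWith L (v t)) (hv : ∀ x, Continuous fun t => v t x)
    (hM : ∀ t x, ‖v t x‖ ≤ M) {a b : ℝ} (hab : a ≤ b) (x₀ : E) :
    ∃ x, x a = x₀ ∧ IsIntegralCurveOn x v (Icc a b) := by
  have hM0 : 0 ≤ M := (norm_nonneg _).trans (hM a x₀)
  have hpl : IsPicardLindelof v (⟨a, le_rfl, hab⟩ : Icc a b) x₀
      (⟨M * (b - a), mul_nonneg hM0 (sub_nonneg.2 hab)⟩ : NNReal) 0 ⟨M, hM0⟩ L :=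
    { lipschitzOnWith := fun t _ => (hL t).lipschitzOnWith
      continuousOn := fun x _ => (hv x).continuousOn
      norm_le := fun t _ x _ => hM t x
      mul_max_le := by
        change M * max (b - a) (a - a) ≤ M * (b - a) - 0
        simp [hab] }
  exact hpl.exists_eq_forall_mem_Icc_hasDerivWithinAt₀

theorem isIntegralCurveOn_of_tendsto {ι : Type*} {F : Filter ι} [F.NeBot] {v : ℝ → E → E}
    {L : NNReal} (hL : ∀ t, LipschitzWith L (v t)) {x : ι → ℝ → E} {w y : ℝ → E} {a b : ℝ}
    (hx : ∀ᶠ k in F, IsIntegralCurveOn (x k) v (Icc a b))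
    (hlim : ∀ t ∈ Icc a b, Tendsto (fun k => x k t) F (𝓝 (y t)))
    (hw : IsIntegralCurveOn w v (Icc a b)) (hwa : w a = y a) :
    IsIntegralCurveOn y v (Icc a b) := by
  have heq : EqOn y w (Icc a b) := fun t ht => by
    refine tendsto_nhds_unique (hlim t ht) (tendsto_iff_dist_tendsto_zero.2 ?_)
    have hstart := (tendsto_iff_dist_tendsto_zero.1
      (hlim a (left_mem_Icc.2 (ht.1.trans ht.2)))).mul_const (Real.exp (L * (t - a)))
    rw [zero_mul] at hstart
    refine squeeze_zero' (Eventually.of_forall fun _ => dist_nonneg) ?_ hstart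
    filter_upwards [hx] with k hk
    exact dist_le_of_trajectories_ODE hL hk.continuousOn
      (fun t ht => hasDerivWithinAt_Ici_of_isIntegralCurveOn hk ht) hw.continuousOn
      (fun t ht => hasDerivWithinAt_Ici_of_isIntegralCurveOn hw ht) (by rw [hwa]) t ht
  intro t ht
  rw [heq ht]
  exact (hw t ht).congr heq (heq ht)

theorem exists_lipschitzWith_eventuallyEq {V W : Type*} [NormedAddCommGroup V] [NormedSpace ℝ V]
    [FiniteDimensional ℝ V] [NormedAddCommGroup W] [NormedSpace ℝ W] {φ : V → W} {q : V}
    (hφ : ContDiffAt ℝ 1 φ q) :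
    ∃ (ψ : V → W) (L : NNReal) (M : ℝ), LipschitzWith L ψ ∧ (∀ z, ‖ψ z‖ ≤ M) ∧ ψ =ᶠ[𝓝 q] φ := by
  obtain ⟨ρ, hρ, hsmooth⟩ := nhds_basis_closedBall.eventually_iff.1 (hφ.eventually (by simp))
  let β : ContDiffBump q := ⟨ρ / 2, ρ, half_pos hρ, half_lt_self hρ⟩
  have hsupp : HasCompactSupport fun z => β z • φ z := β.hasCompactSupport.smul_right
  have hC1 : ContDiff ℝ 1 fun z => β z • φ z :=
    contMDiff_iff_contDiff.1 <| contMDiff_of_tsupport fun z hz => ContDiffAt.contMDiffAt <|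
      β.contDiffAt.smul (hsmooth (β.tsupport_eq ▸ tsupport_smul_subset_left _ _ hz))
  obtain ⟨M, hM⟩ := hC1.continuous.bounded_above_of_compact_support hsupp
  obtain ⟨L, hL⟩ := hC1.lipschitzWith_of_hasCompactSupport hsupp one_ne_zero
  refine ⟨_, L, M, hL, hM, ?_⟩
  filter_upwards [β.eventuallyEq_one] with z hz
  rw [hz, Pi.one_apply, one_smul]

namespace IsDissipativeNear

variable {P F : Type*} [PseudoMetricSpace P] [NormedAddCommGroup F] [InnerProductSpace ℝ F]
  {S : E →L[ℝ] F} {c ρ : ℝ} {f : E → P → E} {l : P} {p : E} {μ : ℝ → P}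

theorem eventually_mem_closedBall (h : IsDissipativeNear S c ρ f l p)
    (hcont : ContinuousAt (f p) l) (hp : f p l = 0) (hμ : Tendsto μ atBot (𝓝 l)) {η : ℝ}
    (hη : 0 < η) :
    ∀ᶠ t in atBot, ∀ a ≤ t, ∀ x, x a = p → IsIntegralCurveOn x (drivenField f μ) (Icc a t) →
      x t ∈ closedBall p η := by
  obtain ⟨δ, hδ, htrap⟩ := h.exists_trap hcont hp hη
  obtain ⟨b, hb⟩ := eventually_atBot.1 (hμ.eventually_mem (closedBall_mem_nhds l hδ))
  filter_upwards [eventually_le_atBot b] with t ht a hat x hxa hx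
  exact htrap μ x a t hx (fun s hs => hb s (hs.2.trans ht)) (hxa ▸ mem_closedBall_self hδ.le) t
    (right_mem_Icc.2 hat)

theorem exists_isIntegralCurveOn_tendsto_atBot [ProperSpace E] (h : IsDissipativeNear S c ρ f l p)
    {L : NNReal} {M : ℝ} (hL : LipschitzWith L (Function.uncurry f)) (hM : ∀ x m, ‖f x m‖ ≤ M)
    (hp : f p l = 0) (hμ : Continuous μ) (hμl : Tendsto μ atBot (𝓝 l)) :
    ∃ b x, IsIntegralCurveOn x (drivenField f μ) (Iio b) ∧ Tendsto x atBot (𝓝 p) := by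
  have hLx (t : ℝ) : LipschitzWith L (drivenField f μ t) := by
    simpa using! hL.comp (LipschitzWith.prodMk_right (μ t))
  have hf (x : E) : Continuous (f x) := hL.continuous.comp (Continuous.prodMk_right x)
  have hex {a b : ℝ} (hab : a ≤ b) := exists_isIntegralCurveOn_of_lipschitzWith hLx
    (fun x => (hf x).comp hμ) (fun t x => hM x (μ t)) hab
  have htrap {η : ℝ} (hη : 0 < η) :=
    eventually_atBot.1 (h.eventually_mem_closedBall (hf p).continuousAt hp hμl hη)
  obtain ⟨b, hb⟩ := htrap one_pos
  choose x hxp hx using fun k : ℕ => hex (sub_le_self b k.cast_nonneg) p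
  have hx_mono {k : ℕ} {a t : ℝ} (ha : b - k ≤ a) (ht : t ≤ b) :=
    (hx k).mono (Icc_subset_Icc ha ht)
  have hdefined (a : ℝ) : ∀ᶠ k : ℕ in atTop, b - k ≤ a :=
    (tendsto_natCast_atTop_atTop.eventually_ge_atTop (b - a)).mono fun _ => sub_le_comm.1
  -- The solution is a limit, along an ultrafilter, of the solutions `x k` that start at `p` at time
  -- `b - k`; dissipativity traps all of them near `p`.
  let 𝒰 : Ultrafilter ℕ := Ultrafilter.of atTop
  have h𝒰 : ↑𝒰 ≤ (atTop : Filter ℕ) := Ultrafilter.of_le _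
  have hlim (t : ℝ) (ht : t ≤ b) : ∃ y, Tendsto (fun k => x k t) 𝒰 (𝓝 y) := by
    have hmem : closedBall p 1 ∈ 𝒰.map fun k => x k t :=
      h𝒰 ((hdefined t).mono fun k hk => hb t ht _ hk _ (hxp k) (hx_mono le_rfl ht))
    obtain ⟨y, -, hy⟩ := (isCompact_closedBall p 1).ultrafilter_le_nhds' _ hmem
    exact ⟨y, hy⟩
  choose! y hy using hlim
  refine ⟨b, y, fun t ht => ?_, nhds_basis_closedBall.tendsto_right_iff.2 fun η hη => ?_⟩
  · have ht : t < b := ht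
    obtain ⟨w, hwa, hw⟩ := hex (show t - 1 ≤ b by linarith) (y (t - 1))
    have hcurve := isIntegralCurveOn_of_tendsto hLx
      (h𝒰 ((hdefined (t - 1)).mono fun k hk => hx_mono hk le_rfl))
      (fun s hs => hy s hs.2) hw hwa
    exact ((hcurve t ⟨by linarith, ht.le⟩).hasDerivAt
      (Icc_mem_nhds (by linarith) ht)).hasDerivWithinAt
  · obtain ⟨b', hb'⟩ := htrap hη
    filter_upwards [eventually_le_atBot b, eventually_le_atBot b'] with t ht ht'
    refine isClosed_closedBall.mem_of_tendsto (hy t ht) (h𝒰 ?_)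
    filter_upwards [hdefined t] with k hk
    exact hb' t ht' _ hk _ (hxp k) (hx_mono le_rfl ht)

theorem eq_of_tendsto_atBot (h : IsDissipativeNear S c ρ f l p) (hμ : Tendsto μ atBot (𝓝 l))
    {b : ℝ} {x y : ℝ → E} (hx : IsIntegralCurveOn x (drivenField f μ) (Iio b))
    (hy : IsIntegralCurveOn y (drivenField f μ) (Iio b)) (hxp : Tendsto x atBot (𝓝 p))
    (hyp : Tendsto y atBot (𝓝 p)) : ∀ᶠ t in atBot, x t = y t := by
  have hnear := closedBall_mem_nhds p h.radius_pos
  obtain ⟨b', hb'⟩ := eventually_atBot.1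
    ((hμ.eventually_mem (closedBall_mem_nhds l h.radius_pos)).and
      ((hxp.eventually_mem hnear).and ((hyp.eventually_mem hnear).and (eventually_lt_atBot b))))
  filter_upwards [eventually_le_atBot b'] with t ht
  have hdecay : Tendsto (fun a => (‖S‖ * (2 * ρ)) ^ 2 * Real.exp (-c * (t - a))) atBot (𝓝 0) := by
    have : Tendsto (fun a => -c * (t - a)) atBot atBot :=
      (tendsto_atTop_add_const_left _ t tendsto_neg_atBot_atTop).const_mul_atTop_of_neg
        (neg_neg_of_pos h.rate_pos)
    simpa using (Real.tendsto_exp_comp_nhds_zero.2 this).const_mul ((‖S‖ * (2 * ρ)) ^ 2)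
  have hle : ‖x t - y t‖ ^ 2 ≤ 0 := by
    refine ge_of_tendsto hdecay ((eventually_le_atBot t).mono fun a hat => ?_)
    have hsub : Icc a t ⊆ Iio b := fun s hs => (hb' s (hs.2.trans ht)).2.2.2
    refine (h.norm_sub_sq_le_of_isIntegralCurveOn hat (hx.mono hsub) (hy.mono hsub)
      (fun s hs => (hb' s (hs.2.trans ht)).1) (fun s hs => (hb' s (hs.2.trans ht)).2.1)
      (fun s hs => (hb' s (hs.2.trans ht)).2.2.1)).trans ?_
    gcongr
    rw [← dist_eq_norm, two_mul]
    exact dist_triangle_right _ _ p |>.trans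
      (add_le_add (hb' a (hat.trans ht)).2.1 (hb' a (hat.trans ht)).2.2.1)
  exact sub_eq_zero.1 (norm_eq_zero.1 (pow_eq_zero_iff two_ne_zero |>.1
    (hle.antisymm (sq_nonneg _))))

end IsDissipativeNear

end PullbackSolutions

section PullbackAttractor

variable {n : ℕ} {U : Set (Space n)} {f : Space n → ℝ → Space n} {l : ℝ} {p : Space n}

theorem IsAttractingEquilibrium.exists_isIntegralCurveOn_tendsto_atBot
    (hp : IsAttractingEquilibrium U f l p) (hU : IsOpen U)
    (hf : ContDiffOn ℝ 1 (Function.uncurry f) (U ×ˢ univ)) {μ : ℝ → ℝ}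
    (hμ : Continuous μ) (hμl : Tendsto μ atBot (𝓝 l)) :
    ∃ b x, IsIntegralCurveOn x (drivenField f μ) (Iio b) ∧ (∀ t < b, x t ∈ U) ∧
      Tendsto x atBot (𝓝 p) := by
  obtain ⟨_, S, c, ρ, h⟩ := hp.exists_isDissipativeNear hU hf
  obtain ⟨ψ, L, M, hL, hM, hψ⟩ := exists_lipschitzWith_eventuallyEq (q := (p, l))
    (hf.contDiffAt ((hU.prod isOpen_univ).mem_nhds ⟨hp.mem, mem_univ l⟩))
  obtain ⟨ρ', hρ', hψf⟩ := nhds_basis_closedBall.eventually_iff.1 hψ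
  have hg : IsDissipativeNear S c (min ρ ρ') (Function.curry ψ) l p := by
    refine (h.mono (lt_min h.radius_pos hρ') (min_le_left _ _)).congr fun m hm x hx =>
      (@hψf (x, m) ?_).symm
    rw [← closedBall_prod_same]
    exact ⟨closedBall_subset_closedBall (min_le_right _ _) hx,
      closedBall_subset_closedBall (min_le_right _ _) hm⟩
  obtain ⟨b, x, hx, hxp⟩ := hg.exists_isIntegralCurveOn_tendsto_atBot hL (fun x m => hM (x, m))
    (hψ.self_of_nhds.trans hp.eq_zero) hμ hμl
  obtain ⟨b', hb'⟩ := eventually_atBot.1 ((hxp.eventually_mem (hU.mem_nhds hp.mem)).and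
    ((hxp.prodMk_nhds hμl).eventually hψ))
  refine ⟨min b b', x, fun t ht => ?_,
    fun t ht => (hb' t (ht.trans_le (min_le_right _ _)).le).1, hxp⟩
  have ht : t < min b b' := ht
  rw [show drivenField f μ t (x t) = Function.curry ψ (x t) (μ t) from
    (hb' t (ht.trans_le (min_le_right _ _)).le).2.symm]
  exact (hx t (ht.trans_le (min_le_left _ _))).mono (Iio_subset_Iio (min_le_left _ _))

variable {Λ : ℝ → ℝ} {r : ℝ}

theorem IsTrajectory.isIntegralCurveOn {b : EReal} {x : ℝ → Space n}
    (hx : IsTrajectory U f Λ r b x) {s : Set ℝ} (hs : ∀ t ∈ s, (t : EReal) < b) :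
    IsIntegralCurveOn x (drivenField f fun t => Λ (r * t)) s :=
  fun t ht => (hx t (hs t ht)).2.hasDerivWithinAt

theorem IsTrajectory.eq_of_tendsto_atBot (hp : IsAttractingEquilibrium U f l p) (hU : IsOpen U)
    (hf : ContDiffOn ℝ 1 (Function.uncurry f) (U ×ˢ univ)) (hΛ : Continuous Λ)
    (hΛl : Tendsto (fun t => Λ (r * t)) atBot (𝓝 l)) {b c : EReal} {x y : ℝ → Space n}
    (hx : IsTrajectory U f Λ r b x) (hy : IsTrajectory U f Λ r c y)
    (hxp : Tendsto x atBot (𝓝 p)) (hyp : Tendsto y atBot (𝓝 p)) {t : ℝ}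
    (htb : (t : EReal) < b) (htc : (t : EReal) < c) : x t = y t := by
  obtain ⟨_, _, _, _, h⟩ := hp.exists_isDissipativeNear hU hf
  have hlt {s : ℝ} (hs : s ≤ t) : (s : EReal) < b ∧ (s : EReal) < c :=
    ⟨(EReal.coe_le_coe hs).trans_lt htb, (EReal.coe_le_coe hs).trans_lt htc⟩
  obtain ⟨a, hxya, hat⟩ := ((h.eq_of_tendsto_atBot hΛl (b := t)
    (hx.isIntegralCurveOn fun s hs => (hlt (le_of_lt hs)).1)
    (hy.isIntegralCurveOn fun s hs => (hlt (le_of_lt hs)).2) hxp hyp).and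
    (eventually_le_atBot t)).exists
  exact eqOn_of_isIntegralCurveOn hU hf (hΛ.comp (continuous_const_mul r)).continuousOn
    (hx.isIntegralCurveOn fun s hs => (hlt hs.2).1) (fun s hs => (hx s (hlt hs.2).1).1)
    (hy.isIntegralCurveOn fun s hs => (hlt hs.2).2) (fun s hs => (hy s (hlt hs.2).2).1) hxya
    (right_mem_Icc.2 hat)

theorem exists_isPullbackAttractor (hp : IsAttractingEquilibrium U f l p) (hU : IsOpen U)
    (hf : ContDiffOn ℝ 1 (Function.uncurry f) (U ×ˢ univ)) (hΛ : Continuous Λ)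
    (hΛl : Tendsto (fun t => Λ (r * t)) atBot (𝓝 l)) :
    ∃ b x, IsPullbackAttractor U f Λ r p b x := by
  let B : Set EReal := {b | ∃ y, IsTrajectory U f Λ r b y ∧ Tendsto y atBot (𝓝 p)}
  have hglue (t : ℝ) : ∃ z, ∀ b y, IsTrajectory U f Λ r b y → Tendsto y atBot (𝓝 p) →
      (t : EReal) < b → y t = z := by
    by_cases ht : ∃ b y, IsTrajectory U f Λ r b y ∧ Tendsto y atBot (𝓝 p) ∧ (t : EReal) < b
    · obtain ⟨b, y, hy, hyp, htb⟩ := ht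
      exact ⟨y t, fun c w hw hwp htc =>
        hw.eq_of_tendsto_atBot hp hU hf hΛ hΛl hy hwp hyp htc htb⟩
    · push Not at ht
      exact ⟨p, fun b y hy hyp htb => absurd htb (ht b y hy hyp).not_gt⟩
  choose x hx using hglue
  obtain ⟨b₀, y₀, hy₀, hy₀U, hy₀p⟩ := hp.exists_isIntegralCurveOn_tendsto_atBot hU hf
    (hΛ.comp (continuous_const_mul r)) hΛl
  have htraj₀ : IsTrajectory U f Λ r b₀ y₀ := fun t ht =>
    have ht := EReal.coe_lt_coe_iff.1 ht
    ⟨hy₀U t ht, (hy₀ t ht).hasDerivAt (Iio_mem_nhds ht)⟩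
  refine ⟨sSup B, x, (EReal.bot_lt_coe b₀).trans_le (le_sSup ⟨y₀, htraj₀, hy₀p⟩), fun t ht => ?_,
    hy₀p.congr' ?_, fun c y hy hyp => ⟨le_sSup ⟨y, hy, hyp⟩, fun t => hx t c y hy hyp⟩⟩
  · obtain ⟨b, ⟨y, hy, hyp⟩, htb⟩ := lt_sSup_iff.1 ht
    rw [← hx t b y hy hyp htb]
    refine ⟨(hy t htb).1, (hy t htb).2.congr_of_eventuallyEq ?_⟩
    filter_upwards [continuous_coe_real_ereal.continuousAt.eventually_lt_const htb] with s hs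
    exact (hx s b y hy hyp hs).symm
  · filter_upwards [eventually_lt_atBot b₀] with t ht
    exact hx t b₀ y₀ htraj₀ hy₀p (EReal.coe_lt_coe ht)

theorem exists_isTrajectory_of_not_rTips {q : Space n} (hp : IsAttractingEquilibrium U f l p)
    (hU : IsOpen U) (hf : ContDiffOn ℝ 1 (Function.uncurry f) (U ×ˢ univ)) (hΛ : Continuous Λ)
    (hΛl : Tendsto Λ atBot (𝓝 l)) (hr : 0 < r) (hRT : ¬ RTips U f Λ r p q) :
    ∃ x, IsTrajectory U f Λ r ⊤ x ∧ Tendsto x atBot (𝓝 p) ∧ Tendsto x atTop (𝓝 q) := by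
  obtain ⟨b, x, hx⟩ := exists_isPullbackAttractor hp hU hf hΛ
    (hΛl.comp (tendsto_id.const_mul_atBot hr))
  obtain ⟨rfl, hxq⟩ := not_not.1 fun h => hRT ⟨b, x, hx, h⟩
  exact ⟨x, hx.trajectory, hx.tendsto_atBot, hxq⟩

end PullbackAttractor

section LargeRate

variable {n : ℕ} {U : Set (Space n)} {f : Space n → ℝ → Space n} {Λ : ℝ → ℝ} {lm lp : ℝ}
  {Xm Xp Yp : Space n}

theorem IsTrajectory.isIntegralCurve {r : ℝ} {x : ℝ → Space n} (hx : IsTrajectory U f Λ r ⊤ x) :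
    IsIntegralCurve x (drivenField f fun t => Λ (r * t)) :=
  fun t => (hx t (EReal.coe_lt_top t)).2

theorem exists_forall_gt_rTips (hU : IsOpen U)
    (hf : ContDiffOn ℝ 1 (Function.uncurry f) (U ×ˢ univ)) (hΛ : IsParameterShift Λ lm lp)
    (hXm : IsAttractingEquilibrium U f lm Xm) (hYp : IsAttractingEquilibrium U f lp Yp)
    (hne : Yp ≠ Xp) (hXmYp : Xm ∈ basin U f lp Yp) :
    ∃ r₀ > 0, ∀ r > r₀, RTips U f Λ r Xm Xp := by
  obtain ⟨ε, hε, hεX⟩ := nhds_basis_closedBall.mem_iff.1 (isOpen_compl_singleton.mem_nhds hne)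
  obtain ⟨δ, hδ, T, hcapture⟩ := hYp.exists_capture hU hf hXmYp hε
  obtain ⟨τ, hτ, hshort⟩ := exists_mem_closedBall_of_short_time hU hf hXm.mem
    (isCompact_Icc (a := lm) (b := lp)) hδ
  obtain ⟨δm, hδm, htrap⟩ := hXm.exists_trap_Iic hU hf hτ
  obtain ⟨s₁, hs₁⟩ := eventually_atBot.1
    (hΛ.tendsto_atBot.eventually_mem (closedBall_mem_nhds lm hδm))
  obtain ⟨s₂, hs₂, hs₁₂⟩ := (eventually_forall_ge_atTop.2
    (hΛ.tendsto_atTop.eventually_mem (closedBall_mem_nhds lp hδ))).and (eventually_ge_atTop s₁)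
    |>.exists
  refine ⟨(s₂ - s₁) / τ + 1, by have := sub_nonneg.2 hs₁₂; positivity, fun r hr => ?_⟩
  have hr0 : 0 < r := lt_trans (by have := sub_nonneg.2 hs₁₂; positivity) hr
  by_contra hRT
  obtain ⟨x, hx, hxm, hxp⟩ := exists_isTrajectory_of_not_rTips hXm hU hf hΛ.contDiff.continuous
    hΛ.tendsto_atBot hr0 hRT
  have hcurve := hx.isIntegralCurve
  have hpast : x (s₁ / r) ∈ closedBall Xm τ :=
    htrap _ x _ (hcurve.isIntegralCurveOn _) (fun t ht => hs₁ _ ((le_div_iff₀' hr0).1 ht)) hxm _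
      le_rfl
  have hjump : x (s₂ / r) ∈ closedBall Xm δ := by
    refine hshort _ x _ _ (hcurve.isIntegralCurveOn _)
      (fun t _ => Ioo_subset_Icc_self (hΛ.mem_Ioo _)) hpast ?_ _
      (right_mem_Icc.2 (div_le_div_of_nonneg_right hs₁₂ hr0.le))
    rw [← sub_div, div_le_iff₀' hr0, ← div_le_iff₀ hτ]
    linarith
  have hfuture : ∀ᶠ t in atTop, x t ∈ closedBall Yp ε := by
    filter_upwards [eventually_ge_atTop (s₂ / r + T)] with t ht
    exact hcapture _ x _ t (hcurve.isIntegralCurveOn _)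
      (fun s hs => hs₂ _ ((div_le_iff₀' hr0).1 hs.1)) hjump (by linarith)
  exact hεX (isClosed_closedBall.mem_of_tendsto hxp hfuture) rfl

end LargeRate

section FastForward

/-- The reparametrization `σ` of the real line that runs at unit speed, except that it jumps over
the interval `(u, v)` during `[0, δ]`: `σ s = u + s` for `s ≤ 0` and `σ s = v + s` for `s ≥ δ`. -/
noncomputable def fastForward (u v δ s : ℝ) : ℝ :=
  u + s + (v - u) * Real.smoothTransition (s / δ)

variable {u v δ s : ℝ}

theorem fastForward_of_nonpos (hδ : 0 < δ) (hs : s ≤ 0) : fastForward u v δ s = u + s := by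
  rw [fastForward, Real.smoothTransition.zero_of_nonpos (div_nonpos_of_nonpos_of_nonneg hs hδ.le)]
  ring

theorem fastForward_of_le (hδ : 0 < δ) (hs : δ ≤ s) : fastForward u v δ s = v + s := by
  rw [fastForward, Real.smoothTransition.one_of_one_le ((one_le_div hδ).2 hs)]
  ring

theorem isReparametrization_fastForward (huv : u < v) (hδ : 0 < δ) :
    IsReparametrization (fastForward u v δ) where
  contDiff := by
    have : ContDiff ℝ 2 fun s => Real.smoothTransition (s / δ) :=
      Real.smoothTransition.contDiff.comp (contDiff_id.div_const δ)
    unfold fastForward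
    fun_prop
  deriv_pos s := by
    have hψ : DifferentiableAt ℝ (fun s => Real.smoothTransition (s / δ)) s :=
      ((Real.smoothTransition.contDiff (n := 1)).differentiable one_ne_zero _).comp s
        (differentiableAt_id.div_const δ)
    have hmono : Monotone fun s => Real.smoothTransition (s / δ) :=
      Real.smoothTransition.monotone.comp fun s t hst => div_le_div_of_nonneg_right hst hδ.le
    have hderiv := ((hasDerivAt_id s).const_add u).add (hψ.hasDerivAt.const_mul (v - u))
    refine hderiv.deriv.symm ▸ add_pos_of_pos_of_nonneg one_pos ?_
    exact mul_nonneg (sub_nonneg.2 huv.le) hmono.deriv_nonneg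
  tendsto_atBot := by
    refine (tendsto_atBot_add_const_left _ u tendsto_id).congr' ?_
    filter_upwards [eventually_le_atBot 0] with s hs using (fastForward_of_nonpos hδ hs).symm
  tendsto_atTop := by
    refine (tendsto_atTop_add_const_left _ v tendsto_id).congr' ?_
    filter_upwards [eventually_ge_atTop δ] with s hs using (fastForward_of_le hδ hs).symm

theorem IsParameterShift.comp_fastForward {Λ : ℝ → ℝ} {lm lp : ℝ} (hΛ : IsParameterShift Λ lm lp)
    (huv : u < v) (hδ : 0 < δ) : IsParameterShift (Λ ∘ fastForward u v δ) lm lp := by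
  have hσ := isReparametrization_fastForward huv hδ
  refine ⟨hΛ.contDiff.comp hσ.contDiff, fun s => hΛ.mem_Ioo _, hΛ.tendsto_atBot.comp
    hσ.tendsto_atBot, hΛ.tendsto_atTop.comp hσ.tendsto_atTop, ?_, ?_⟩
  · refine (hΛ.deriv_atBot.comp (tendsto_atBot_add_const_left _ u tendsto_id)).congr' ?_
    filter_upwards [eventually_lt_atBot 0] with s hs
    have : Λ ∘ fastForward u v δ =ᶠ[𝓝 s] fun s => Λ (u + s) := by
      filter_upwards [Iio_mem_nhds hs] with t ht
      rw [Function.comp_apply, fastForward_of_nonpos hδ (le_of_lt ht)]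
    rw [this.deriv_eq, deriv_comp_const_add, Function.comp_apply, id]
  · refine (hΛ.deriv_atTop.comp (tendsto_atTop_add_const_left _ v tendsto_id)).congr' ?_
    filter_upwards [eventually_gt_atTop δ] with s hs
    have : Λ ∘ fastForward u v δ =ᶠ[𝓝 s] fun s => Λ (v + s) := by
      filter_upwards [Ioi_mem_nhds hs] with t ht
      rw [Function.comp_apply, fastForward_of_le hδ (le_of_lt ht)]
    rw [this.deriv_eq, deriv_comp_const_add, Function.comp_apply, id]

end FastForward

section SlowDriving

/-- For every small rate `r > 0`, the curve `x r` solves `ẋ = f(x, M(r t))` as long as the slow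
time `r * t` lies in `I`. -/
def IsSlowSolution {E P : Type*} [NormedAddCommGroup E] [NormedSpace ℝ E] (f : E → P → E)
    (M : ℝ → P) (x : ℝ → ℝ → E) (I : Set ℝ) : Prop :=
  ∀ᶠ r in 𝓝[>] 0, IsIntegralCurveOn (x r) (drivenField f fun t => M (r * t)) {t | r * t ∈ I}

theorem IsSlowSolution.mono {E P : Type*} [NormedAddCommGroup E] [NormedSpace ℝ E] {f : E → P → E}
    {M : ℝ → P} {x : ℝ → ℝ → E} {I J : Set ℝ} (hx : IsSlowSolution f M x J) (hIJ : I ⊆ J) :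
    IsSlowSolution f M x I :=
  Eventually.mono hx fun _ hr => hr.mono fun _ ht => hIJ ht

theorem tendsto_const_div_nhdsGT_zero {c : ℝ} (hc : 0 < c) :
    Tendsto (fun r => c / r) (𝓝[>] 0) atTop := by
  simpa only [div_eq_mul_inv] using tendsto_inv_nhdsGT_zero.const_mul_atTop hc

theorem mul_mem_Icc_of_mem_Icc_div {a b r t : ℝ} (hr : 0 < r) (ht : t ∈ Icc (a / r) (b / r)) :
    r * t ∈ Icc a b :=
  ⟨(div_le_iff₀' hr).1 ht.1, (le_div_iff₀' hr).1 ht.2⟩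

variable {n : ℕ} {U : Set (Space n)} {f : Space n → ℝ → Space n} {M : ℝ → ℝ} {l : ℝ}
  {Z : ℝ → Space n} {p : Space n} {x : ℝ → ℝ → Space n}

theorem IsAttractingEquilibrium.exists_tendsto_of_isSlowSolution
    (hp : IsAttractingEquilibrium U f l p) (hU : IsOpen U)
    (hf : ContDiffOn ℝ 1 (Function.uncurry f) (U ×ˢ univ)) :
    ∃ ρ > 0, ∀ (M : ℝ → ℝ) (x : ℝ → ℝ → Space n) (a b : ℝ), ContinuousAt M b → a < b →
      IsSlowSolution f M x (Icc a b) → (∀ s ∈ Icc a b, M s ∈ closedBall l ρ) →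
      (∀ᶠ r in 𝓝[>] 0, ∀ t ∈ Icc (a / r) (b / r), x r t ∈ closedBall p ρ) →
      ∀ q ∈ closedBall p ρ, f q (M b) = 0 →
        Tendsto (fun r => x r (b / r)) (𝓝[>] 0) (𝓝 q) := by
  obtain ⟨ρ, hρ, hrelax⟩ := hp.exists_relaxation hU hf
  refine ⟨ρ, hρ, fun M x a b hM hab hx hMl hxp q hq hfq =>
    nhds_basis_closedBall.tendsto_right_iff.2 fun ε hε => ?_⟩
  obtain ⟨δ, hδ, T, -, hrelax⟩ := hrelax q hq (M b) hfq ε hε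
  obtain ⟨a', ha', hMδ⟩ := (mem_nhdsLE_iff_exists_mem_Ico_Ioc_subset hab).1
    (mem_nhdsWithin_of_mem_nhds (hM.eventually_mem (closedBall_mem_nhds (M b) hδ)))
  obtain ⟨c, hac, hcb⟩ := exists_between ha'.2
  have hlong : ∀ᶠ r in 𝓝[>] (0 : ℝ), T ≤ (b - c) / r :=
    (tendsto_const_div_nhdsGT_zero (sub_pos.2 hcb)).eventually_ge_atTop T
  filter_upwards [hx, hxp, hlong, self_mem_nhdsWithin] with r hxr hxpr hT hr
  have hr : 0 < r := hr
  have hsub : Icc (c / r) (b / r) ⊆ Icc (a / r) (b / r) :=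
    Icc_subset_Icc_left (div_le_div_of_nonneg_right (ha'.1.trans hac.le) hr.le)
  have hslow (t : ℝ) (ht : t ∈ Icc (a / r) (b / r)) := mul_mem_Icc_of_mem_Icc_div hr ht
  refine hrelax _ (x r) (c / r) (b / r) (hxr.mono fun t ht => hslow t (hsub ht))
    (fun t ht => ⟨hMl _ (hslow t (hsub ht)), hMδ ?_⟩) (fun t ht => hxpr t (hsub ht))
    (by rwa [← sub_div])
  exact Icc_subset_Ioc_iff (hcb.le) |>.2 ⟨hac, le_rfl⟩ (mul_mem_Icc_of_mem_Icc_div hr ht)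

theorem IsStablePath.exists_tendsto_of_isSlowSolution (hZ : IsStablePath U f M Z) (hU : IsOpen U)
    (hf : ContDiffOn ℝ 1 (Function.uncurry f) (U ×ˢ univ)) (hM : Continuous M) (s₀ : ℝ) :
    ∃ δ > 0, ∀ (x : ℝ → ℝ → Space n) (a b : ℝ), a < b → Icc a b ⊆ closedBall s₀ δ →
      IsSlowSolution f M x (Icc a b) → (∀ᶠ r in 𝓝[>] 0, x r (a / r) ∈ closedBall (Z s₀) δ) →
      Tendsto (fun r => x r (b / r)) (𝓝[>] 0) (𝓝 (Z b)) := by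
  obtain ⟨ρ, hρ, htrack⟩ := (hZ.attracting s₀).exists_tendsto_of_isSlowSolution hU hf
  obtain ⟨η, hη, htrap⟩ := (hZ.attracting s₀).exists_trap hU hf hρ
  have hnear : ∀ᶠ s in 𝓝 s₀, M s ∈ closedBall (M s₀) (min η ρ) ∧ Z s ∈ closedBall (Z s₀) ρ :=
    (hM.continuousAt.eventually_mem (closedBall_mem_nhds _ (lt_min hη hρ))).and
      (hZ.continuous.continuousAt.eventually_mem (closedBall_mem_nhds _ hρ))
  obtain ⟨δ, hδ, hnear⟩ := nhds_basis_closedBall.eventually_iff.1 hnear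
  refine ⟨min δ η, lt_min hδ hη, fun x a b hab hsub hx hxa => ?_⟩
  have hIcc {s : ℝ} (hs : s ∈ Icc a b) :=
    hnear (closedBall_subset_closedBall (min_le_left _ _) (hsub hs))
  refine htrack M x a b hM.continuousAt hab hx
    (fun s hs => closedBall_subset_closedBall (min_le_right _ _) (hIcc hs).1) ?_ (Z b)
    (hIcc (right_mem_Icc.2 hab.le)).2 (hZ.attracting b).eq_zero
  filter_upwards [hx, hxa, self_mem_nhdsWithin] with r hxr hxar hr
  exact htrap _ (x r) _ _ (hxr.mono fun t ht => mul_mem_Icc_of_mem_Icc_div hr ht)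
    (fun t ht => closedBall_subset_closedBall (min_le_left _ _)
      (hIcc (mul_mem_Icc_of_mem_Icc_div hr ht)).1)
    (closedBall_subset_closedBall (min_le_right _ _) hxar)

theorem IsStablePath.tendsto_of_isSlowSolution (hZ : IsStablePath U f M Z) (hU : IsOpen U)
    (hf : ContDiffOn ℝ 1 (Function.uncurry f) (U ×ˢ univ)) (hM : Continuous M) {a b : ℝ}
    (hab : a ≤ b) (hx : IsSlowSolution f M x (Icc a b))
    (hxa : Tendsto (fun r => x r (a / r)) (𝓝[>] 0) (𝓝 (Z a))) :
    Tendsto (fun r => x r (b / r)) (𝓝[>] 0) (𝓝 (Z b)) := by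
  choose δ hδ hlocal using hZ.exists_tendsto_of_isSlowSolution hU hf hM
  let V (s : ℝ) : Set ℝ := ball s (δ s) ∩ Z ⁻¹' ball (Z s) (δ s)
  have hV (s : ℝ) : IsOpen (V s) := isOpen_ball.inter (isOpen_ball.preimage hZ.continuous)
  obtain ⟨t, ht₀, hmono, ⟨m, hm⟩, hcover⟩ := exists_monotone_Icc_subset_open_cover_Icc hab
    (c := fun s : ℝ => ((↑) : Icc a b → ℝ) ⁻¹' V s)
    (fun s => (hV s).preimage continuous_subtype_val)
    (fun s _ => mem_iUnion.2 ⟨s, mem_ball_self (hδ _), mem_ball_self (hδ _)⟩)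
  suffices h : ∀ k, Tendsto (fun r => x r (t k / r)) (𝓝[>] 0) (𝓝 (Z (t k))) by
    simpa only [hm m le_rfl] using h m
  intro k
  induction k with
  | zero => rwa [ht₀]
  | succ k ih =>
    obtain heq | hlt := (hmono k.le_succ).eq_or_lt
    · rwa [← heq]
    obtain ⟨s, hs⟩ := hcover k
    have hks : (t k : ℝ) ∈ V s := hs (left_mem_Icc.2 hlt.le)
    refine hlocal s x (t k) (t (k + 1)) hlt (fun c hc => ?_)
      (hx.mono (Icc_subset_Icc (t k).2.1 (t (k + 1)).2.2))
      ((ih.eventually_mem (isOpen_ball.mem_nhds hks.2)).mono fun _ h => ball_subset_closedBall h)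
    exact ball_subset_closedBall
      (@hs ⟨c, (t k).2.1.trans hc.1, hc.2.trans (t (k + 1)).2.2⟩ ⟨hc.1, hc.2⟩).1

theorem IsStablePath.tendsto_of_tendsto_atBot (hZ : IsStablePath U f M Z) (hU : IsOpen U)
    (hf : ContDiffOn ℝ 1 (Function.uncurry f) (U ×ˢ univ)) (hM : Continuous M)
    (hMl : Tendsto M atBot (𝓝 l)) (hZp : Tendsto Z atBot (𝓝 p))
    (hp : IsAttractingEquilibrium U f l p) {b : ℝ} (hx : IsSlowSolution f M x (Iic b))
    (hxp : ∀ᶠ r in 𝓝[>] 0, Tendsto (x r) atBot (𝓝 p)) :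
    Tendsto (fun r => x r (b / r)) (𝓝[>] 0) (𝓝 (Z b)) := by
  obtain ⟨ρ, hρ, htrack⟩ := hp.exists_tendsto_of_isSlowSolution hU hf
  obtain ⟨η, hη, htrap⟩ := hp.exists_trap_Iic hU hf hρ
  obtain ⟨s, hs⟩ := eventually_atBot.1
    ((hMl.eventually_mem (closedBall_mem_nhds l (lt_min hη hρ))).and
      ((hZp.eventually_mem (closedBall_mem_nhds p hρ)).and (eventually_le_atBot b)))
  have hsb : s ≤ b := (hs s le_rfl).2.2
  refine hZ.tendsto_of_isSlowSolution hU hf hM hsb (hx.mono Icc_subset_Iic_self)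
    (htrack M x (s - 1) s hM.continuousAt (sub_one_lt s)
      (hx.mono (Icc_subset_Iic_self.trans (Iic_subset_Iic.2 hsb)))
      (fun c hc => closedBall_subset_closedBall (min_le_right _ _) (hs c hc.2).1) ?_ (Z s)
      (hs s le_rfl).2.1 (hZ.attracting s).eq_zero)
  filter_upwards [hx, hxp, self_mem_nhdsWithin] with r hxr hxpr hr t ht
  have hslow {t : ℝ} (ht : t ≤ s / r) : r * t ≤ s := (le_div_iff₀' hr).1 ht
  exact htrap _ (x r) (s / r) (hxr.mono fun t ht => (hslow ht).trans hsb)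
    (fun t ht => closedBall_subset_closedBall (min_le_left _ _) (hs _ (hslow ht)).1) hxpr t ht.2

theorem IsStablePath.eventually_mem_closedBall_of_tendsto_atTop (hZ : IsStablePath U f M Z)
    (hU : IsOpen U) (hf : ContDiffOn ℝ 1 (Function.uncurry f) (U ×ˢ univ)) (hM : Continuous M)
    (hMl : Tendsto M atTop (𝓝 l)) (hZp : Tendsto Z atTop (𝓝 p))
    (hp : IsAttractingEquilibrium U f l p) {a : ℝ} (hx : IsSlowSolution f M x (Ici a))
    (hxa : Tendsto (fun r => x r (a / r)) (𝓝[>] 0) (𝓝 (Z a))) {ε : ℝ} (hε : 0 < ε) :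
    ∀ᶠ r in 𝓝[>] 0, ∀ᶠ t in atTop, x r t ∈ closedBall p ε := by
  obtain ⟨δ, hδ, htrap⟩ := hp.exists_trap hU hf hε
  obtain ⟨b, hMb, hZb, hab⟩ := ((eventually_forall_ge_atTop.2
    (hMl.eventually_mem (closedBall_mem_nhds l hδ))).and
      ((hZp.eventually_mem (ball_mem_nhds p hδ)).and (eventually_ge_atTop a))).exists
  have hxb := hZ.tendsto_of_isSlowSolution hU hf hM hab (hx.mono Icc_subset_Ici_self) hxa
  filter_upwards [hx, hxb.eventually_mem (isOpen_ball.mem_nhds hZb), self_mem_nhdsWithin]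
    with r hxr hxbr hr
  have hslow {t : ℝ} (ht : b / r ≤ t) : b ≤ r * t := (div_le_iff₀' hr).1 ht
  filter_upwards [eventually_ge_atTop (b / r)] with t ht
  exact htrap _ (x r) (b / r) t (hxr.mono fun s hs => hab.trans (hslow hs.1))
    (fun s hs => hMb _ (hslow hs.1)) (ball_subset_closedBall hxbr) t (right_mem_Icc.2 ht)

end SlowDriving

section FastForwardTipping

variable {n : ℕ} {U : Set (Space n)} {f : Space n → ℝ → Space n} {Λ : ℝ → ℝ} {lm lp u v : ℝ}
  {p q : Space n} {x : ℝ → ℝ → Space n}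

theorem isSlowSolution_Iic_of_fastForward
    (hx : ∀ r > 0, IsIntegralCurve (x r)
      (drivenField f fun t => Λ (fastForward u v (r ^ 2) (r * t)))) :
    IsSlowSolution f (fun s => Λ (u + s)) x (Iic 0) := by
  filter_upwards [self_mem_nhdsWithin] with r hr t ht
  have hσ : fastForward u v (r ^ 2) (r * t) = u + r * t := fastForward_of_nonpos (pow_pos hr 2) ht
  simpa only [drivenField, hσ] using (hx r hr).isIntegralCurveOn _ t ht

theorem isSlowSolution_Ici_of_fastForward
    (hx : ∀ r > 0, IsIntegralCurve (x r)
      (drivenField f fun t => Λ (fastForward u v (r ^ 2) (r * t)))) {a : ℝ} (ha : 0 < a) :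
    IsSlowSolution f (fun s => Λ (v + s)) x (Ici a) := by
  have hsq : Tendsto (fun r : ℝ => r ^ 2) (𝓝[>] 0) (𝓝 0) :=
    ((continuous_pow 2).tendsto' 0 0 (by simp)).mono_left nhdsWithin_le_nhds
  filter_upwards [hsq.eventually_le_const ha, self_mem_nhdsWithin] with r hra hr t ht
  have hσ : fastForward u v (r ^ 2) (r * t) = v + r * t :=
    fastForward_of_le (pow_pos hr 2) (hra.trans ht)
  simpa only [drivenField, hσ] using (hx r hr).isIntegralCurveOn _ t ht

theorem eventually_mem_closedBall_of_fastForward (hU : IsOpen U)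
    (hf : ContDiffOn ℝ 1 (Function.uncurry f) (U ×ˢ univ)) (hΛ : IsParameterShift Λ lm lp)
    (hp : IsAttractingEquilibrium U f (Λ v) p) (hq : q ∈ basin U f (Λ v) p)
    (hx : ∀ r > 0, IsIntegralCurve (x r)
      (drivenField f fun t => Λ (fastForward u v (r ^ 2) (r * t))))
    (hxq : Tendsto (fun r => x r 0) (𝓝[>] 0) (𝓝 q)) {ε : ℝ} (hε : 0 < ε) :
    ∀ᶠ a in 𝓝[>] 0, ∀ᶠ r in 𝓝[>] 0, x r (a / r) ∈ closedBall p ε := by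
  obtain ⟨δ, hδ, T, hcapture⟩ := hp.exists_capture hU hf hq hε
  have hqU : q ∈ U := let ⟨_, hz0, hz, _⟩ := hq; hz0 ▸ (hz 0 le_rfl).1
  obtain ⟨τ, hτ, hshort⟩ := exists_mem_closedBall_of_short_time hU hf hqU
    (isCompact_Icc (a := lm) (b := lp)) hδ
  have hΛv : ∀ᶠ s in 𝓝 0, Λ (v + s) ∈ closedBall (Λ v) δ := by
    refine (hΛ.contDiff.continuous.comp (continuous_const_add v)).continuousAt.eventually_mem ?_
    simpa using closedBall_mem_nhds (Λ v) hδ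
  obtain ⟨a₀, ha₀, hΛv⟩ := nhds_basis_closedBall.eventually_iff.1 hΛv
  filter_upwards [Ioc_mem_nhdsGT ha₀] with a ha
  filter_upwards [hxq.eventually_mem (closedBall_mem_nhds q hτ), Ioc_mem_nhdsGT hτ,
    (tendsto_const_div_nhdsGT_zero ha.1).eventually_ge_atTop (T + τ)] with r hxr hr hlong
  have hjump : x r r ∈ closedBall q δ :=
    hshort _ (x r) 0 r ((hx r hr.1).isIntegralCurveOn _)
      (fun t _ => Ioo_subset_Icc_self (hΛ.mem_Ioo _)) hxr (by linarith [hr.2]) r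
      (right_mem_Icc.2 hr.1.le)
  refine hcapture _ (x r) r (a / r) ((hx r hr.1).isIntegralCurveOn _) (fun t ht => ?_) hjump
    (by linarith [hr.2])
  have hr2 : r ^ 2 ≤ r * t := by
    rw [sq]
    exact mul_le_mul_of_nonneg_left ht.1 hr.1.le
  rw [fastForward_of_le (pow_pos hr.1 2) hr2]
  apply hΛv
  rw [mem_closedBall, dist_zero_right, Real.norm_of_nonneg ((sq_nonneg r).trans hr2)]
  exact ((le_div_iff₀' hr.1).1 ht.2).trans ha.2

theorem exists_fastForward_rTips {X Y : ℝ → Space n} {Xm Xp Yp : Space n} (hU : IsOpen U)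
    (hf : ContDiffOn ℝ 1 (Function.uncurry f) (U ×ˢ univ)) (hΛ : IsParameterShift Λ lm lp)
    (hX : IsStablePath U f Λ X) (hXlim : Tendsto X atBot (𝓝 Xm))
    (hXm : IsAttractingEquilibrium U f lm Xm) (hY : IsStablePath U f Λ Y)
    (hYlim : Tendsto Y atTop (𝓝 Yp)) (hYp : IsAttractingEquilibrium U f lp Yp) (hne : Yp ≠ Xp)
    (huv : u < v) (hu : X u ∈ basin U f (Λ v) (Y v)) :
    ∃ r > 0, RTips U f (Λ ∘ fastForward u v (r ^ 2)) r Xm Xp := by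
  -- The jump over `(u, v)` takes the slow time `r ^ 2`, hence the time `r`, in which the solution
  -- hardly moves.
  by_contra! hRT
  have htraj (r : ℝ) (hr : 0 < r) := by
    have hΛσ := hΛ.comp_fastForward huv (pow_pos hr 2)
    exact exists_isTrajectory_of_not_rTips hXm hU hf hΛσ.contDiff.continuous hΛσ.tendsto_atBot hr
      (hRT r hr)
  choose! x hx hxm hxp using htraj
  have hcurve (r : ℝ) (hr : r > 0) := (hx r hr).isIntegralCurve
  have hcont (s : ℝ) := hΛ.contDiff.continuous.comp (continuous_const_add s)
  have hpast : Tendsto (fun r => x r 0) (𝓝[>] 0) (𝓝 (X u)) := by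
    simpa using (hX.comp_add u).tendsto_of_tendsto_atBot hU hf (hcont u)
      (hΛ.tendsto_atBot.comp (tendsto_atBot_add_const_left _ u tendsto_id))
      (hXlim.comp (tendsto_atBot_add_const_left _ u tendsto_id)) hXm
      (isSlowSolution_Iic_of_fastForward hcurve) (eventually_mem_nhdsWithin.mono hxm)
  have hslow {a : ℝ} (ha : 0 < a) := isSlowSolution_Ici_of_fastForward hcurve ha
  obtain ⟨δ, hδ, htrack⟩ := (hY.comp_add v).exists_tendsto_of_isSlowSolution hU hf (hcont v) 0
  obtain ⟨a, hxa, ha⟩ := ((eventually_mem_closedBall_of_fastForward hU hf hΛ (hY.attracting v) hu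
    hcurve hpast hδ).and (Ioo_mem_nhdsGT hδ)).exists
  have hjumped : Tendsto (fun r => x r (δ / r)) (𝓝[>] 0) (𝓝 (Y (v + δ))) :=
    htrack x a δ ha.2 (fun s hs => by simp [abs_of_nonneg (ha.1.le.trans hs.1), hs.2])
      ((hslow ha.1).mono Icc_subset_Ici_self) (by simpa using hxa)
  obtain ⟨ε, hε, hεX⟩ := nhds_basis_closedBall.mem_iff.1 (isOpen_compl_singleton.mem_nhds hne)
  obtain ⟨r, hfuture, hr⟩ := (((hY.comp_add v).eventually_mem_closedBall_of_tendsto_atTop hU hf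
    (hcont v) (hΛ.tendsto_atTop.comp (tendsto_atTop_add_const_left _ v tendsto_id))
    (hYlim.comp (tendsto_atTop_add_const_left _ v tendsto_id)) hYp (hslow hδ) hjumped hε).and
    self_mem_nhdsWithin).exists
  exact hεX (isClosed_closedBall.mem_of_tendsto (hxp r hr) hfuture) rfl

end FastForwardTipping

end RateTipping

theorem theorem3p5_general (n : ℕ) (U : Set (RateTipping.Space n)) (hU : IsOpen U)
    (f : RateTipping.Space n → ℝ → RateTipping.Space n)
    (hf : ContDiffOn ℝ 1 (fun q : RateTipping.Space n × ℝ => f q.1 q.2) (U ×ˢ Set.univ))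
    (Λ : ℝ → ℝ) (lm lp : ℝ) (hΛ : RateTipping.IsParameterShift Λ lm lp)
    (X : ℝ → RateTipping.Space n) (hX : RateTipping.IsStablePath U f Λ X)
    (Xm Xp : RateTipping.Space n)
    (hXm : Tendsto X atBot (𝓝 Xm)) (hXp : Tendsto X atTop (𝓝 Xp))
    (hXm_attr : RateTipping.IsAttractingEquilibrium U f lm Xm) :
    (∀ (Y : ℝ → RateTipping.Space n) (Yp : RateTipping.Space n),
      RateTipping.IsStablePath U f Λ Y →
      Tendsto Y atTop (𝓝 Yp) →
      RateTipping.IsAttractingEquilibrium U f lp Yp →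
      Yp ≠ Xp →
      (∃ u v : ℝ, u < v ∧ X u ∈ RateTipping.basin U f (Λ v) (Y v)) →
      ¬ RateTipping.IsForwardBasinStable U f Λ X ∧
      ∃ σ : ℝ → ℝ, RateTipping.IsReparametrization σ ∧
        RateTipping.IsParameterShift (Λ ∘ σ) lm lp ∧
        ∃ r : ℝ, 0 < r ∧ RateTipping.RTips U f (Λ ∘ σ) r Xm Xp) ∧
    (∀ Yp : RateTipping.Space n,
      RateTipping.IsAttractingEquilibrium U f lp Yp →
      Yp ≠ Xp →
      Xm ∈ RateTipping.basin U f lp Yp →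
      ¬ RateTipping.IsForwardBasinStable U f Λ X ∧
      ∃ r₀ : ℝ, 0 < r₀ ∧ ∀ r : ℝ, r₀ < r → RateTipping.RTips U f Λ r Xm Xp) := by
  refine ⟨fun Y Yp hY hYlim hYp hne ⟨u, v, huv, hu⟩ => ⟨fun hFBS => hne ?_, ?_⟩,
    fun Yp hYp hne hXmYp => ⟨fun hFBS => hne ?_, ?_⟩⟩
  · obtain rfl := hFBS.eq_of_mem_basin hX hY hU hf hΛ.contDiff.continuous huv hu
    exact tendsto_nhds_unique hYlim hXp
  · obtain ⟨r, hr, htips⟩ := RateTipping.exists_fastForward_rTips hU hf hΛ hX hXm hXm_attr hY hYlim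
      hYp hne huv hu
    exact ⟨_, RateTipping.isReparametrization_fastForward huv (pow_pos hr 2),
      hΛ.comp_fastForward huv (pow_pos hr 2), r, hr, htips⟩
  · exact (hFBS.eq_of_lim_mem_basin hU hf hΛ.tendsto_atTop hXm hXp hYp hXmYp).symm
  · exact RateTipping.exists_forall_gt_rTips hU hf hΛ hXm_attr hYp hne hXmYp

theorem theorem3p5 (n : ℕ) (U : Set (RateTipping.Space n)) (hU : IsOpen U)
    (f : RateTipping.Space n → ℝ → RateTipping.Space n)
    (hf : ContDiffOn ℝ 2 (fun q : RateTipping.Space n × ℝ => f q.1 q.2) (U ×ˢ Set.univ))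
    (Λ : ℝ → ℝ) (lm lp : ℝ) (hΛ : RateTipping.IsParameterShift Λ lm lp)
    (X : ℝ → RateTipping.Space n) (hX : RateTipping.IsStablePath U f Λ X)
    (Xm Xp : RateTipping.Space n)
    (hXm : Tendsto X atBot (𝓝 Xm)) (hXp : Tendsto X atTop (𝓝 Xp))
    (hXm_attr : RateTipping.IsAttractingEquilibrium U f lm Xm) :
    (∀ (Y : ℝ → RateTipping.Space n) (Yp : RateTipping.Space n),
      RateTipping.IsStablePath U f Λ Y →
      Tendsto Y atTop (𝓝 Yp) →
      RateTipping.IsAttractingEquilibrium U f lp Yp →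
      Yp ≠ Xp →
      (∃ u v : ℝ, u < v ∧ X u ∈ RateTipping.basin U f (Λ v) (Y v)) →
      ¬ RateTipping.IsForwardBasinStable U f Λ X ∧
      ∃ σ : ℝ → ℝ, RateTipping.IsReparametrization σ ∧
        RateTipping.IsParameterShift (Λ ∘ σ) lm lp ∧
        ∃ r : ℝ, 0 < r ∧ RateTipping.RTips U f (Λ ∘ σ) r Xm Xp) ∧
    (∀ Yp : RateTipping.Space n,
      RateTipping.IsAttractingEquilibrium U f lp Yp →
      Yp ≠ Xp →
      Xm ∈ RateTipping.basin U f lp Yp →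
      ¬ RateTipping.IsForwardBasinStable U f Λ X ∧
      ∃ r₀ : ℝ, 0 < r₀ ∧ ∀ r : ℝ, r₀ < r → RateTipping.RTips U f Λ r Xm Xp) :=
  theorem3p5_general n U hU f (hf.of_le one_le_two) Λ lm lp hΛ X hX Xm Xp hXm hXp hXm_attr
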